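/- Let $G=(V,E)$ be a graph and $Z\subseteq V$ a set of \emph{ghost nodes}. Pairwise disjoint nonempty \emph{clusters} $C_1,\dots,C_k\subseteq V$ and a \emph{separator set} $S\subseteq V$ form a \emph{$(d,x)$-separator decomposition} with regard to $Z$ if: $C_1,\dots,C_k,S$ partition $V$; $\mathrm{dist}_G(u,v)\le d$ for all $u,v$ in the same cluster; $|S|\le x$; and there is no edge $\{u,v\}\in E$ with $u\in C_i\setminus Z$, $v\in C_j\setminus Z$, $i\ne j$. A deterministic $\mathsf{LOCAL}$ algorithm \emph{computes} such a decomposition if every node learns whether it is in $S$, every cluster has a unique ID and a leader node (not necessarily in the cluster), and every node of a cluster learns the cluster's ID and a path of length at most $d$ in $G$ from itself to the cluster's leader. Nodes have unique IDs from a space $\{0,\dots,N-1\}$ of size $N$ polynomial in $n$ and know $N$; messages and local computation are unbounded. A graph is a \emph{cactus} if each of its edges belongs to at most one cycle (it need not be connected). Write $\alpha\oplus\beta$ for the symmetric difference. \textbf{Lemma (Cactus-Core Decomposition).} For each $\varepsilon>0$ there is a deterministic $\mathsf{LOCAL}$ algorithm that, for any connected $n$-node graph $G=(V,E)$ and any vertex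 covers $\alpha,\beta$ of $G$ (each node knows its membership in $\alpha$ and in $\beta$) such that $G[\alpha\oplus\beta]$ is a cactus, computes a $(d,x)$-separator decomposition of $G$ with ghost set $Z=V\setminus(\alpha\oplus\beta)$, $d=O(\max\{1,1/\varepsilon\})$, $x=\varepsilon|\alpha\oplus\beta|$ and at most $\max\{1,2\varepsilon M\}$ clusters, where $M=\max\{|\alpha|,|\beta|\}$, in $O(\max\{1,1/\varepsilon\}\cdot\max\{1,\log^* n\})$ rounds. The constant in the bound on $d$ is absolute, and the constant in the number of rounds depends only on the polynomial bounding $N$. (For $\varepsilon\le 1$ and $n\ge 2$ these bounds read $d=O(1/\varepsilon)$ and $O(\log^*(n)/\varepsilon)$ rounds.) -/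

import Mathlib

/-- The iterated logarithm to base `2`: the least number `k` of applications of `log₂` that
takes `n` to a value `≤ 1`; equivalently, the least `k` such that `n` is at most the power tower
`2 ^ 2 ^ ⋯ ^ 2` of height `k` (the tower of height `0` being `1`). -/
noncomputable def logStar (n : ℕ) : ℕ :=
  sInf {k : ℕ | n ≤ (fun m : ℕ => 2 ^ m)^[k] 1}

/-- A (not necessarily connected) cactus graph: every edge belongs to at most one cycle. Two closed
walks describe the same cycle if they use the same edges. -/
def SimpleGraph.IsCactus {V : Type*} (G : SimpleGraph V) : Prop :=
  ∀ (e : Sym2 V) (u v : V) (p : G.Walk u u) (q : G.Walk v v),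
    p.IsCycle → q.IsCycle → e ∈ p.edges → e ∈ q.edges → ∀ f : Sym2 V, f ∈ p.edges ↔ f ∈ q.edges

/-- The clusters `C 0, …, C (k - 1)` and the separator set `S` form a (weak) `(d, x)`-separator
decomposition of `G` with regard to the set `Z` of ghost nodes. -/
structure IsSeparatorDecomposition {V : Type*} [Fintype V] [DecidableEq V] (G : SimpleGraph V)
    (Z : Finset V) (d x : ℝ) {k : ℕ} (C : Fin k → Finset V) (S : Finset V) : Prop where
  /-- Clusters are nonempty ... -/
  nonempty : ∀ i, (C i).Nonempty
  /-- ... pairwise disjoint ... -/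
  disjoint : ∀ i j, i ≠ j → Disjoint (C i) (C j)
  /-- ... disjoint from the separator set ... -/
  disjoint_separator : ∀ i, Disjoint (C i) S
  /-- ... and cover all vertices together with it. -/
  cover : ∀ v, v ∈ S ∨ ∃ i, v ∈ C i
  /-- Each cluster has weak diameter at most `d`: distances are measured in `G`. -/
  weak_diam : ∀ i, ∀ u ∈ C i, ∀ v ∈ C i, G.Reachable u v ∧ (G.dist u v : ℝ) ≤ d
  /-- The separator set is small. -/
  card_separator : (S.card : ℝ) ≤ x
  /-- No edge joins non-ghost vertices of two different clusters. -/
  separates : ∀ i j, i ≠ j → ∀ u ∈ C i \ Z, ∀ v ∈ C j \ Z, ¬ G.Adj u v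

/-- The data of a communication network on the graph `G`: unique identifiers, and for every node
a numbering of its incident links by ports `0, …, deg v - 1`. -/
structure LocalNetwork {V : Type*} (G : SimpleGraph V) where
  /-- The identifier of a node. -/
  id : V → ℕ
  /-- Identifiers are unique. -/
  id_injective : Function.Injective id
  /-- The degree of a node. -/
  deg : V → ℕ
  /-- The neighbor at the other end of a port. -/
  port : ∀ v, Fin (deg v) ≃ G.neighborSet v

/-- A deterministic algorithm in the LOCAL model: local computation and message size are
unbounded. The nodes know a bound `N` such that the identifiers are taken from `{0, …, N - 1}`;
they know nothing else about the size or the structure of the network. -/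
structure LocalAlgorithm (In Out : Type) where
  /-- Local states of nodes. -/
  State : Type
  /-- Messages. -/
  Msg : Type
  /-- The number of rounds, depending on the size `N` of the identifier space. -/
  rounds : ℕ → ℕ
  /-- The initial state, from the size `N` of the identifier space, the identifier of the node,
  its degree and its local input. -/
  init : (N ident deg : ℕ) → In → State
  /-- The message that a node in a given state sends through a given port. -/
  send : State → ℕ → Msg
  /-- The new state, from the old one and the messages received through the ports. -/
  receive : State → (deg : ℕ) → (Fin deg → Msg) → State
  /-- The output of a node in its final state. -/
  output : State → Out

namespace LocalAlgorithm

variable {In Out : Type} {V : Type*} {G : SimpleGraph V}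

/-- The state of every node after `t` synchronous rounds. In a round, the node `v` receives through
port `p` the message that the neighbor at this port sends through its own port leading to `v`. -/
def stateAfter (A : LocalAlgorithm In Out) (W : LocalNetwork G) (N : ℕ) (inp : V → In) :
    ℕ → V → A.State
  | 0, v => A.init N (W.id v) (W.deg v) (inp v)
  | t + 1, v => A.receive (stateAfter A W N inp t v) (W.deg v) fun p =>
      A.send (stateAfter A W N inp t (W.port v p).1)
        ((W.port (W.port v p).1).symm ⟨v, (W.port v p).2.symm⟩ : ℕ)

/-- The outputs of the nodes at the end of the execution. -/
def result (A : LocalAlgorithm In Out) (W : LocalNetwork G) (N : ℕ) (inp : V → In) (v : V) : Out :=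
  A.output (A.stateAfter W N inp (A.rounds N) v)

end LocalAlgorithm

/-- What a node outputs in the distributed computation of a separator decomposition: that it is in
the separator set, or else the identifier of its cluster together with a path to the leader of the
cluster, given by the list of the identifiers of the nodes on the path. -/
inductive DecompOutput : Type
  | separator : DecompOutput
  | clustered (clusterId : ℕ) (path : List ℕ) : DecompOutput

/-- The outputs `out` describe the clusters `C` and the separator set `S` in the distributed sense:
nodes know whether they are in `S`; each cluster has a unique identifier and a leader (a node that
need not belong to the cluster); each node of a cluster knows the identifier of the cluster and a
path of length at most `d` in `G` from itself to the leader. -/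
def OutputsDecomposition {V : Type*} {G : SimpleGraph V} (W : LocalNetwork G) (d : ℝ) {k : ℕ}
    (C : Fin k → Finset V) (S : Finset V) (out : V → DecompOutput) : Prop :=
  (∀ v ∈ S, out v = DecompOutput.separator) ∧
  ∃ (clusterId : Fin k → ℕ) (leader : Fin k → V), Function.Injective clusterId ∧
    ∀ i, ∀ v ∈ C i, ∃ p : G.Walk v (leader i), p.IsPath ∧ (p.length : ℝ) ≤ d ∧
      out v = DecompOutput.clustered (clusterId i) (p.support.map W.id)

/-! A function on labeled graphs whose value at a node depends only on the ball of radius `T` is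
computable in `T + 1` rounds (`result_ofLocal`), so it is enough to construct suitable partitions
and to bound the radius on which they depend. Fix a power of two `t` with `2 / ε ≤ t = O(max 1 (1 /
ε))`.

Fragments are grown by doubling (`exists_double`). Every fragment with fewer than `2 * θ` vertices
that has an outside neighbor points to one. Cole–Vishkin reduction colors these pointers with 8
colors after `logStar N` iterations, and each fragment follows pointers until a large or isolated
fragment, or a local color minimum at which a fragment of larger color points. A merged fragment
that is not a component thus contains one fragment of size `2 * θ` or two of size `θ`. The cost of a
phase is proportional to `θ`, so the phases form a geometric sum (`exists_pow`).

Applied to the core `G[α ⊕ β]`, this gives connected fragments of size at least `t`, apart from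
whole components. At most `|α ⊕ β| / t` crossing edges connect the fragments of each component.
Every other crossing edge closes a cycle through one of these, and in a cactus different edges use
different ones. Hence there are at most `2|α ⊕ β| / t ≤ ε|α ⊕ β|` crossing edges
(`card_crossing_le`), and the smaller endpoint of each goes to the separator.

Small core components could still produce too many clusters. Merging therefore continues, from the
core fragments, in the graph joining vertices of `α ∪ β` at distance at most 2. That graph is
connected because `α ∪ β` is a vertex cover, so there is one cluster or at most `|α ∪ β| / t` of
them. The remaining nodes join a neighbor. Clusters respect core fragments, so outside the separator
no core edge joins two of them. -/

/-! ### Balls in terms of walk length -/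

namespace SimpleGraph

variable {V : Type*} {G : SimpleGraph V}

/-- `v` can be reached from `u` by a walk of length at most `r`. -/
def Within (G : SimpleGraph V) (r : ℕ) (u v : V) : Prop :=
  ∃ p : G.Walk u v, p.length ≤ r

namespace Within

lemma refl (r : ℕ) (v : V) : G.Within r v v := ⟨.nil, by simp⟩

lemma mono {r s : ℕ} {u v : V} (h : G.Within r u v) (hrs : r ≤ s) : G.Within s u v :=
  let ⟨p, hp⟩ := h
  ⟨p, hp.trans hrs⟩

lemma symm {r : ℕ} {u v : V} (h : G.Within r u v) : G.Within r v u :=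
  let ⟨p, hp⟩ := h
  ⟨p.reverse, by simpa using hp⟩

lemma trans {r s : ℕ} {u v w : V} (h : G.Within r u v) (h' : G.Within s v w) :
    G.Within (r + s) u w :=
  let ⟨p, hp⟩ := h
  let ⟨q, hq⟩ := h'
  ⟨p.append q, by rw [Walk.length_append]; omega⟩

lemma of_adj {u v : V} (h : G.Adj u v) : G.Within 1 u v := ⟨.cons h .nil, by simp⟩

end Within

lemma within_zero_iff {u v : V} : G.Within 0 u v ↔ u = v := by
  constructor
  · rintro ⟨p, hp⟩
    exact Walk.eq_of_length_eq_zero (Nat.le_zero.1 hp)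
  · rintro rfl
    exact .refl _ _

lemma within_succ_iff {r : ℕ} {u v : V} :
    G.Within (r + 1) u v ↔ u = v ∨ ∃ w, G.Adj u w ∧ G.Within r w v := by
  constructor
  · rintro ⟨p, hp⟩
    cases p with
    | nil => exact .inl rfl
    | cons h q => exact .inr ⟨_, h, q, by simpa using hp⟩
  · rintro (rfl | ⟨w, h, q, hq⟩)
    · exact .refl _ _
    · exact ⟨.cons h q, by simpa using hq⟩

lemma Within.of_mem_support {r : ℕ} {u v w : V} {p : G.Walk u v} (hp : p.length ≤ r)
    (hw : w ∈ p.support) : G.Within r u w := by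
  classical
  exact ⟨p.takeUntil w hw, (p.length_takeUntil_le_length hw).trans hp⟩

end SimpleGraph

/-! ### Local functions of labeled graphs -/

/-- A graph with node labels whose vertices are the possible identifiers. -/
structure LabeledGraph (N : ℕ) (In : Type) where
  /-- The underlying graph. -/
  graph : SimpleGraph (Fin N)
  /-- The local input of a node. -/
  label : Fin N → In

namespace LabeledGraph

variable {N : ℕ} {In : Type}

/-- `I` and `J` have the same edges and labels at all nodes that are within distance `r`
from `v` in `I`. -/
def Agree (I J : LabeledGraph N In) (r : ℕ) (v : Fin N) : Prop :=
  ∀ u, I.graph.Within r v u →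
    I.graph.neighborSet u = J.graph.neighborSet u ∧ I.label u = J.label u

variable {I J : LabeledGraph N In} {r s : ℕ} {u v w : Fin N}

lemma Agree.mono (h : Agree I J r v) (hs : s ≤ r) : Agree I J s v :=
  fun u hu => h u (hu.mono hs)

lemma Agree.of_within (h : Agree I J r v) (hu : I.graph.Within s v u) {t : ℕ} (ht : s + t ≤ r) :
    Agree I J t u :=
  fun w hw => h w ((hu.trans hw).mono ht)

lemma Agree.label_eq (h : Agree I J r v) : I.label v = J.label v := (h v (.refl _ _)).2

lemma Agree.adj_iff (h : Agree I J r v) : I.graph.Adj v w ↔ J.graph.Adj v w := by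
  have := (h v (.refl _ _)).1
  rw [← SimpleGraph.mem_neighborSet, this, SimpleGraph.mem_neighborSet]

/-- A walk in `J` is transferred to `I` vertex by vertex, each step staying in the ball of
agreement. This makes `Agree` symmetric although only balls of `I` occur in it. -/
lemma Agree.within (h : Agree I J r v) (hu : J.graph.Within r v u) : I.graph.Within r v u := by
  induction r generalizing v with
  | zero => exact SimpleGraph.within_zero_iff.2 (SimpleGraph.within_zero_iff.1 hu)
  | succ r ih =>
    rw [SimpleGraph.within_succ_iff] at hu ⊢
    refine hu.imp_right ?_
    rintro ⟨w, hvw, hw⟩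
    have hvw' := h.adj_iff.2 hvw
    exact ⟨w, hvw', ih (h.of_within (.of_adj hvw') (by omega)) hw⟩

lemma Agree.symm (h : Agree I J r v) : Agree J I r v := fun u hu =>
  let h' := h u (h.within hu)
  ⟨h'.1.symm, h'.2.symm⟩

/-- The value of `F` at a node depends only on the part of the labeled graph within
distance `T`. -/
def IsLocal {B : Type*} (F : LabeledGraph N In → Fin N → B) (T : ℕ) : Prop :=
  ∀ I J v, Agree I J T v → F I v = F J v

variable {B C D : Type*} {F : LabeledGraph N In → Fin N → B} {T : ℕ}

lemma IsLocal.mono (h : IsLocal F T) {T' : ℕ} (hT : T ≤ T') : IsLocal F T' :=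
  fun I J v hv => h I J v (hv.mono hT)

lemma isLocal_label : IsLocal (fun I : LabeledGraph N In => I.label) 0 :=
  fun _ _ _ h => h.label_eq

lemma isLocal_neighborSet : IsLocal (fun I : LabeledGraph N In => I.graph.neighborSet) 0 :=
  fun _ _ v h => (h v (.refl _ _)).1

lemma IsLocal.map (h : IsLocal F T) (g : B → C) : IsLocal (fun I v => g (F I v)) T :=
  fun I J v hv => congrArg g (h I J v hv)

lemma IsLocal.map₂ {F' : LabeledGraph N In → Fin N → C} (h : IsLocal F T) (h' : IsLocal F' T)
    (g : B → C → D) : IsLocal (fun I v => g (F I v) (F' I v)) T :=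
  fun I J v hv => congrArg₂ g (h I J v hv) (h' I J v hv)

/-- Evaluation at a node that is determined locally. -/
lemma IsLocal.comp (hF : IsLocal F T) {j : LabeledGraph N In → Fin N → Fin N} {T' r : ℕ}
    (hj : IsLocal j T') (hr : ∀ (I : LabeledGraph N In) v, I.graph.Within r v (j I v)) (hT : T' ≤ T + r) :
    IsLocal (fun I v => F I (j I v)) (T + r) := by
  intro I J v hv
  change F I (j I v) = F J (j J v)
  rw [← hj I J v (hv.mono hT)]
  exact hF I J _ (hv.of_within (hr I v) (Nat.add_comm r T).le)

end LabeledGraph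

/-! ### Networks as labeled graphs, and simulation of local functions -/

namespace LocalNetwork

variable {V : Type*} {G : SimpleGraph V} {In : Type}

/-- Identifiers below `N` as an embedding into `Fin N`. -/
def emb (W : LocalNetwork G) {N : ℕ} (hN : ∀ v, W.id v < N) : V ↪ Fin N where
  toFun v := ⟨W.id v, hN v⟩
  inj' u v h := W.id_injective (by simpa using h)

@[simp] lemma emb_val (W : LocalNetwork G) {N : ℕ} (hN : ∀ v, W.id v < N) (v : V) :
    (W.emb hN v : ℕ) = W.id v := rfl

/-- The labeled graph on the identifiers that describes a network with inputs; unused identifiers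
are isolated vertices with label `x`. -/
noncomputable def toLabeled (W : LocalNetwork G) {N : ℕ} (hN : ∀ v, W.id v < N) (inp : V → In)
    (x : In) : LabeledGraph N In where
  graph := G.map (W.emb hN)
  label := Function.extend (W.emb hN) inp fun _ => x

lemma toLabeled_label (W : LocalNetwork G) {N : ℕ} (hN : ∀ v, W.id v < N) (inp : V → In)
    (x : In) (v : V) : (W.toLabeled hN inp x).label (W.emb hN v) = inp v :=
  (W.emb hN).injective.extend_apply inp (fun _ => x) v

lemma toLabeled_label_of_notMem (W : LocalNetwork G) {N : ℕ} (hN : ∀ v, W.id v < N)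
    (inp : V → In) (x : In) {j : Fin N} (hj : ¬ ∃ v, W.emb hN v = j) :
    (W.toLabeled hN inp x).label j = x :=
  Function.extend_apply' inp (fun _ => x) j hj

lemma exists_of_within (W : LocalNetwork G) {N : ℕ} (hN : ∀ v, W.id v < N) {r : ℕ} {v : V}
    {j : Fin N} (h : (G.map (W.emb hN)).Within r (W.emb hN v) j) :
    ∃ u, W.emb hN u = j ∧ G.Within r v u := by
  induction r generalizing v with
  | zero => exact ⟨v, SimpleGraph.within_zero_iff.1 h, .refl _ _⟩
  | succ r ih =>
    obtain h | ⟨w, hw, h⟩ := SimpleGraph.within_succ_iff.1 h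
    · exact ⟨v, h, .refl _ _⟩
    · obtain ⟨v', w', hvw, hv, rfl⟩ := (SimpleGraph.map_adj _ _ _ _).1 hw
      obtain rfl := (W.emb hN).injective hv
      obtain ⟨u, hu, h⟩ := ih ‹_›
      exact ⟨u, hu, SimpleGraph.within_succ_iff.2 (.inr ⟨w', hvw, h⟩)⟩

end LocalNetwork

namespace LocalAlgorithm

open LabeledGraph

variable {In Out : Type}

/-- What a node knows while it explores its neighborhood: the size of the identifier space, its
identifier, its input, the identifiers of its neighbors, and the identifiers, inputs and neighbor
identifiers of nodes it has heard of. -/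
structure Knowledge (In : Type) where
  /-- The size of the identifier space. -/
  size : ℕ
  /-- The identifier of the node. -/
  ident : ℕ
  /-- The input of the node. -/
  input : In
  /-- The collected records. -/
  records : Set (ℕ × In × Set ℕ)

/-- A labeled graph that is consistent with given records. -/
def Consistent {N : ℕ} (R : Set (ℕ × In × Set ℕ)) (I : LabeledGraph N In) : Prop :=
  ∀ j : Fin N, ∀ x S, ((j : ℕ), x, S) ∈ R →
    I.label j = x ∧ Fin.val '' I.graph.neighborSet j = S

open Classical in
/-- The algorithm that explores the neighborhood of every node for `T N + 1` rounds and evaluates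
`F` on a labeled graph consistent with what was found. -/
noncomputable def ofLocal (F : ∀ N, LabeledGraph N In → Fin N → Out) (y : Out) (T : ℕ → ℕ) :
    LocalAlgorithm In Out where
  State := Knowledge In
  Msg := Knowledge In
  rounds N := T N + 1
  init N ident _ x := ⟨N, ident, x, ∅⟩
  send s _ := s
  receive s _ m := ⟨s.size, s.ident, s.input,
    insert (s.ident, s.input, Set.range fun p => (m p).ident) (⋃ p, (m p).records)⟩
  output s :=
    if h : s.ident < s.size ∧ ∃ I : LabeledGraph s.size In, Consistent s.records I then
      F s.size h.2.choose ⟨s.ident, h.1⟩ else y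

variable {V : Type*} {G : SimpleGraph V}

lemma stateAfter_ofLocal (F : ∀ N, LabeledGraph N In → Fin N → Out) (y : Out) (T : ℕ → ℕ)
    (W : LocalNetwork G) (N : ℕ) (inp : V → In) (t : ℕ) (v : V) :
    (ofLocal F y T).stateAfter W N inp t v = (⟨N, W.id v, inp v,
      {R | ∃ u, ∃ s, s < t ∧ G.Within s v u ∧
        R = (W.id u, inp u, W.id '' G.neighborSet u)}⟩ : Knowledge In) := by
  induction t generalizing v with
  | zero => simp [stateAfter, ofLocal]
  | succ t ih =>
    rw [stateAfter]
    simp only [ih]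
    simp only [ofLocal, Knowledge.mk.injEq, true_and]
    have hr : (Set.range fun p => W.id (W.port v p).1) = W.id '' G.neighborSet v := by
      ext j
      constructor
      · rintro ⟨p, rfl⟩
        exact ⟨_, (W.port v p).2, rfl⟩
      · rintro ⟨u, hu, rfl⟩
        exact ⟨(W.port v).symm ⟨u, hu⟩, by simp⟩
    rw [hr]
    ext R
    simp only [Set.mem_insert_iff, Set.mem_iUnion, Set.mem_ofPred_eq]
    constructor
    · rintro (rfl | ⟨p, u, s, hs, h, rfl⟩)
      · exact ⟨v, 0, by omega, .refl _ _, rfl⟩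
      · exact ⟨u, s + 1, by omega,
          SimpleGraph.within_succ_iff.2 (.inr ⟨_, (W.port v p).2, h⟩), rfl⟩
    · rintro ⟨u, s, hs, h, rfl⟩
      cases s with
      | zero =>
        obtain rfl := SimpleGraph.within_zero_iff.1 h
        exact .inl rfl
      | succ s =>
        obtain rfl | ⟨w, hw, h⟩ := SimpleGraph.within_succ_iff.1 h
        · exact .inl rfl
        · exact .inr ⟨(W.port v).symm ⟨w, hw⟩, u, s, by omega, by simpa using h, rfl⟩

/-- Every `T`-local function can be computed in `T + 1` rounds. -/
theorem result_ofLocal (F : ∀ N, LabeledGraph N In → Fin N → Out) (y : Out) (T : ℕ → ℕ)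
    (W : LocalNetwork G) {N : ℕ} (hF : IsLocal (F N) (T N)) (hN : ∀ v, W.id v < N)
    (inp : V → In) (x : In) (v : V) :
    (ofLocal F y T).result W N inp v = F N (W.toLabeled hN inp x) (W.emb hN v) := by
  classical
  set R : Set (ℕ × In × Set ℕ) := {R | ∃ u, ∃ s, s < T N + 1 ∧ G.Within s v u ∧
        R = (W.id u, inp u, W.id '' G.neighborSet u)} with hR
  have hnb (u : V) : Fin.val '' (W.toLabeled hN inp x).graph.neighborSet (W.emb hN u) =
      W.id '' G.neighborSet u := by
    ext j
    constructor
    · rintro ⟨j, hj, rfl⟩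
      obtain ⟨u', w, h, hu, rfl⟩ := (SimpleGraph.map_adj _ _ _ _).1 hj
      obtain rfl := (W.emb hN).injective hu
      exact ⟨w, h, rfl⟩
    · rintro ⟨w, hw, rfl⟩
      exact ⟨W.emb hN w, (SimpleGraph.map_adj _ _ _ _).2 ⟨u, w, hw, rfl, rfl⟩, rfl⟩
  have hcons : Consistent R (W.toLabeled hN inp x) := by
    rintro j _ _ ⟨u, s, -, -, h⟩
    simp only [Prod.mk.injEq] at h
    obtain ⟨hj, rfl, rfl⟩ := h
    obtain rfl : j = W.emb hN u := Fin.ext hj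
    exact ⟨W.toLabeled_label .., hnb u⟩
  have hex : W.id v < N ∧ ∃ I : LabeledGraph N In, Consistent R I := ⟨hN v, _, hcons⟩
  have hres : (ofLocal F y T).result W N inp v = F N hex.2.choose ⟨W.id v, hex.1⟩ := by
    rw [result, stateAfter_ofLocal]
    exact dif_pos hex
  rw [hres]
  symm
  -- The chosen consistent graph may be wrong far away, but the records of all nodes within distance
  -- `T N` have arrived, so it agrees with the true graph on that ball.
  refine hF _ _ _ fun j hj => ?_
  obtain ⟨u, rfl, hu⟩ := W.exists_of_within hN hj
  obtain ⟨h1, h2⟩ := hex.2.choose_spec (W.emb hN u) _ _ ⟨u, T N, by omega, hu, rfl⟩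
  refine ⟨Fin.val_injective.image_injective ?_, ?_⟩
  · rw [hnb, h2]
  · rw [h1, W.toLabeled_label]

end LocalAlgorithm

/-! ### The iterated logarithm -/

/-- The power tower `2 ^ 2 ^ ⋯ ^ 2` of height `k`. -/
def tower (k : ℕ) : ℕ := (fun m : ℕ => 2 ^ m)^[k] 1

lemma tower_zero : tower 0 = 1 := rfl

lemma tower_succ (k : ℕ) : tower (k + 1) = 2 ^ tower k := Function.iterate_succ_apply' _ _ _

lemma add_tower_le (k a : ℕ) : tower k + a ≤ tower (k + a) := by
  induction a with
  | zero => rfl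
  | succ a ih =>
    have : tower (k + a) < tower (k + (a + 1)) := by
      rw [← add_assoc, tower_succ]
      exact Nat.lt_two_pow_self
    omega

lemma tower_le_succ (k : ℕ) : tower k ≤ tower (k + 1) := by
  have := add_tower_le k 1
  omega

lemma two_le_tower_succ (k : ℕ) : 2 ≤ tower (k + 1) := by
  have := add_tower_le 0 (k + 1)
  rw [tower_zero, zero_add] at this
  omega

lemma logStar_le {n k : ℕ} (h : n ≤ tower k) : logStar n ≤ k := Nat.sInf_le h

lemma le_tower_logStar (n : ℕ) : n ≤ tower (logStar n) := by
  refine Nat.sInf_mem (s := {k : ℕ | n ≤ tower k}) ⟨n, ?_⟩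
  have := add_tower_le 0 n
  rw [zero_add] at this
  exact (Nat.le_add_left _ _).trans this

/-- The iterated logarithm hardly grows under polynomials. -/
lemma logStar_le_of_le_mul_pow {N n c : ℕ} (h : N ≤ c * n ^ c) :
    logStar N ≤ logStar n + c + 2 := by
  refine logStar_le (h.trans ?_)
  rw [tower_succ, tower_succ]
  set k := logStar n
  have hn : n ≤ 2 ^ tower k := (le_tower_logStar n).trans Nat.lt_two_pow_self.le
  -- Two logarithms turn the polynomial into the additive term `c`, which `add_tower_le` absorbs
  -- into `c` further levels of the tower.
  calc c * n ^ c ≤ 2 ^ c * (2 ^ tower k) ^ c :=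
        Nat.mul_le_mul Nat.lt_two_pow_self.le (Nat.pow_le_pow_left hn c)
    _ = 2 ^ (c * (tower k + 1)) := by rw [← pow_mul, ← pow_add]; ring_nf
    _ ≤ 2 ^ (2 ^ c * 2 ^ tower k) := by
        refine Nat.pow_le_pow_right two_pos (Nat.mul_le_mul Nat.lt_two_pow_self.le ?_)
        exact Nat.lt_two_pow_self
    _ ≤ 2 ^ 2 ^ tower (k + c) := by
        rw [← pow_add]
        refine Nat.pow_le_pow_right two_pos (Nat.pow_le_pow_right two_pos ?_)
        have := add_tower_le k c
        omega

/-! ### Color reduction along pointers, and following pointers to a stop -/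

/-- The Cole–Vishkin color reduction: the position of the lowest bit in which `a` differs from
`b`, together with this bit of `a`. -/
noncomputable def coleVishkin (a b : ℕ) : ℕ :=
  2 * sInf {i | a.testBit i ≠ b.testBit i} + (a.testBit (sInf {i | a.testBit i ≠ b.testBit i})).toNat

lemma exists_testBit_ne {a b : ℕ} (h : a ≠ b) : {i | a.testBit i ≠ b.testBit i}.Nonempty := by
  by_contra hne
  rw [Set.not_nonempty_iff_eq_empty, Set.eq_empty_iff_forall_notMem] at hne
  exact h (Nat.eq_of_testBit_eq fun i => not_not.1 (hne i))

/-- Equal values would mean equal positions and equal bits there, but `a` and `b` differ at that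
position. As `c` is arbitrary, `b` may also be the color of a fixed point, with `c = b`. -/
lemma coleVishkin_ne {a b : ℕ} (h : a ≠ b) (c : ℕ) : coleVishkin a b ≠ coleVishkin b c := by
  intro he
  unfold coleVishkin at he
  have hm := Nat.sInf_mem (exists_testBit_ne h)
  set i := sInf {i | a.testBit i ≠ b.testBit i}
  set j := sInf {i | b.testBit i ≠ c.testBit i}
  have hi := Bool.toNat_le (a.testBit i)
  have hj := Bool.toNat_le (b.testBit j)
  have hij : i = j := by omega
  rw [← hij] at he
  have : (a.testBit i).toNat = (b.testBit i).toNat := by omega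
  cases h1 : a.testBit i <;> cases h2 : b.testBit i <;> simp_all

lemma coleVishkin_lt {a b k : ℕ} (hk : k ≠ 0) (ha : a < 2 ^ k) (hb : b < 2 ^ k) :
    coleVishkin a b < 2 * k := by
  have hi : sInf {i | a.testBit i ≠ b.testBit i} < k := by
    by_cases h : a = b
    · subst h
      simpa using Nat.pos_of_ne_zero hk
    · have hm := Nat.sInf_mem (exists_testBit_ne h)
      by_contra hle
      push Not at hle
      refine hm ?_
      rw [Nat.testBit_lt_two_pow (ha.trans_le (Nat.pow_le_pow_right two_pos hle)),
        Nat.testBit_lt_two_pow (hb.trans_le (Nat.pow_le_pow_right two_pos hle))]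
  have := Bool.toNat_le (a.testBit (sInf {i | a.testBit i ≠ b.testBit i}))
  unfold coleVishkin
  omega

section Coloring

variable {U : Type*} (b : U → U) (C₀ : U → ℕ)

/-- Iterated color reduction along a map `b`. -/
noncomputable def reducedColor : ℕ → U → ℕ
  | 0, v => C₀ v
  | s + 1, v => coleVishkin (reducedColor s v) (reducedColor s (b v))

variable {b C₀}

lemma reducedColor_ne (h : ∀ v, b v ≠ v → C₀ v ≠ C₀ (b v)) (s : ℕ) {v : U} (hv : b v ≠ v) :
    reducedColor b C₀ s v ≠ reducedColor b C₀ s (b v) := by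
  induction s with
  | zero => exact h v hv
  | succ s ih => exact coleVishkin_ne ih _

/-- The factor 4 makes the bound reproduce itself: colors below `4 * 2 ^ x = 2 ^ (2 + x)` become
colors below `2 * (2 + x) ≤ 4 * x` when `2 ≤ x`. At the bottom, `x = 1` gives 6, which is below the
final value 8. -/
lemma reducedColor_lt_tower {k : ℕ} (h : ∀ v, C₀ v < 4 * tower (1 + k)) (s : ℕ) (v : U) :
    reducedColor b C₀ s v < 4 * tower (1 + (k - s)) := by
  induction s generalizing v with
  | zero => exact h v
  | succ s ih =>
    rw [reducedColor]
    have key (j : ℕ) (hj : k - s = j) : coleVishkin (reducedColor b C₀ s v)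
        (reducedColor b C₀ s (b v)) < 2 * (2 + tower j) := by
      refine coleVishkin_lt (by omega) ?_ ?_
      all_goals
        refine (ih _).trans_eq ?_
        rw [hj, add_comm 1, tower_succ, pow_add]
        rfl
    obtain hks | hks := Nat.eq_zero_or_pos (k - s)
    · have := key 0 hks
      have h2 := two_le_tower_succ (k - (s + 1))
      rw [tower_zero] at this
      rw [add_comm 1]
      omega
    · obtain ⟨j, hj⟩ : ∃ j, k - s = j + 1 := ⟨k - s - 1, by omega⟩
      have := key _ hj
      have h2 := two_le_tower_succ j
      rw [show k - (s + 1) = j by omega, add_comm 1]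
      omega

lemma reducedColor_lt_eight {N : ℕ} (h : ∀ v, C₀ v < N) (v : U) :
    reducedColor b C₀ (logStar N) v < 8 := by
  have := reducedColor_lt_tower (b := b) (C₀ := C₀) (k := logStar N) (fun v => ?_) (logStar N) v
  · rwa [Nat.sub_self, tower_succ, tower_zero] at this
  · have h1 := le_tower_logStar N
    have h2 := tower_le_succ (logStar N)
    have := h v
    rw [add_comm 1]
    omega

/-- Follow the map `b` for at most `k` steps until a vertex that satisfies `A`. -/
noncomputable def land (b : U → U) (A : U → Prop) : ℕ → U → U
  | 0, v => v
  | k + 1, v => open Classical in if A v then v else land b A k (b v)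

variable {A : U → Prop}

lemma land_of_mem {v : U} (h : A v) (k : ℕ) : land b A k v = v := by
  cases k with
  | zero => rfl
  | succ k => exact if_pos h

lemma land_succ_of_notMem {v : U} (h : ¬ A v) (k : ℕ) : land b A (k + 1) v = land b A k (b v) :=
  if_neg h

lemma land_succ_eq {k : ℕ} {v : U} (h : A (land b A k v)) : land b A (k + 1) v = land b A k v := by
  induction k generalizing v with
  | zero => exact if_pos h
  | succ k ih =>
    by_cases hv : A v
    · rw [land_of_mem hv, land_of_mem hv]
    · rw [land_succ_of_notMem hv] at h
      rw [land_succ_of_notMem hv, ih h, land_succ_of_notMem hv]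

/-- Guarantees that a landing point other than the start was entered through a genuine pointer,
whose edge is then available at that point. -/
lemma land_eq_or_exists (hA : ∀ v, b v = v → A v) (k : ℕ) (v : U) :
    land b A k v = v ∨ ∃ y, land b A k v = b y ∧ b y ≠ y := by
  induction k generalizing v with
  | zero => exact .inl rfl
  | succ k ih =>
    by_cases hv : A v
    · exact .inl (land_of_mem hv _)
    · rw [land_succ_of_notMem hv]
      obtain h | h := ih (b v)
      · exact .inr ⟨v, h, fun h => hv (hA v h)⟩
      · exact .inr h

variable {C : U → ℕ}

/-- If `A` contains the fixed points of `b` and the local minima of a proper coloring that have a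
preimage of larger color, then every descending sequence ends in `A`. -/
lemma land_mem_of_descending (hC : ∀ v, b v ≠ v → C v ≠ C (b v)) (hfix : ∀ v, b v = v → A v)
    (hmin : ∀ v, b v ≠ v → b (b v) ≠ b v → C (b v) < C v → C (b v) < C (b (b v)) → A (b v))
    (k : ℕ) {v : U} (hv : b v ≠ v) (hlt : C (b v) < C v) (hk : C (b v) ≤ k) :
    A (land b A k (b v)) := by
  induction k generalizing v with
  | zero =>
    by_cases h : b (b v) = b v
    · exact hfix _ h
    · have := hC _ h
      exact hmin v hv h hlt (by omega)
  | succ k ih =>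
    by_cases hA : A (b v)
    · rwa [land_of_mem hA]
    · have h : b (b v) ≠ b v := fun h => hA (hfix _ h)
      have h1 := hC _ h
      have h2 : C (b (b v)) < C (b v) := by
        by_contra h3
        exact hA (hmin v hv h hlt (by omega))
      rw [land_succ_of_notMem hA]
      exact ih h h2 (by omega)

/-- Colors can rise along the pointers for fewer than `K` steps. After the first descent they keep
falling until a fixed point or a local minimum entered from a larger color, which takes at most `K`
further steps. -/
lemma land_mem (hC : ∀ v, b v ≠ v → C v ≠ C (b v)) (hfix : ∀ v, b v = v → A v)
    (hmin : ∀ v, b v ≠ v → b (b v) ≠ b v → C (b v) < C v → C (b v) < C (b (b v)) → A (b v))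
    {K : ℕ} (hK : ∀ v, C v < K) (v : U) : A (land b A (K + K) v) := by
  suffices ∀ j v, K ≤ C v + j → A (land b A (j + K) v) from this K v (by omega)
  intro j
  induction j with
  | zero =>
    intro v hv
    have := hK v
    omega
  | succ j ih =>
    intro v hv
    by_cases hA : A v
    · rwa [land_of_mem hA]
    have h : b v ≠ v := fun h => hA (hfix _ h)
    have h1 := hC _ h
    rw [Nat.add_right_comm, land_succ_of_notMem hA]
    obtain h2 | h2 := h1.lt_or_gt
    · exact ih _ (by omega)
    · exact land_mem_of_descending hC hfix hmin _ h h2 ((hK _).le.trans (by omega))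

end Coloring

/-! ### Merging connected fragments -/

namespace SimpleGraph

variable {V L : Type*}

/-- The edges of `H` between vertices with the same value of `f`. -/
def intra (H : SimpleGraph V) (f : V → L) : SimpleGraph V where
  Adj u v := H.Adj u v ∧ f u = f v
  symm := ⟨fun _ _ h => ⟨h.1.symm, h.2.symm⟩⟩
  loopless := ⟨fun _ h => h.1.ne rfl⟩

variable {H : SimpleGraph V} {f : V → L}

lemma intra_le : H.intra f ≤ H := fun _ _ h => h.1

lemma intra_mono {H' : SimpleGraph V} (h : H ≤ H') : H.intra f ≤ H'.intra f :=
  fun _ _ h' => ⟨h h'.1, h'.2⟩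

lemma eq_of_mem_support_intra {u v w : V} (p : (H.intra f).Walk u v) (hw : w ∈ p.support) :
    f w = f u := by
  induction p with
  | nil => rw [Walk.mem_support_nil_iff.1 hw]
  | cons h q ih =>
    rw [Walk.support_cons, List.mem_cons] at hw
    obtain rfl | hw := hw
    · rfl
    · exact (ih hw).trans h.2.symm

/-- The vertices with the same value of `f` as `v`. -/
def fiber [Fintype V] [DecidableEq L] (f : V → L) (v : V) : Finset V :=
  Finset.univ.filter fun u => f u = f v

lemma mem_fiber [Fintype V] [DecidableEq L] {u v : V} : u ∈ fiber f v ↔ f u = f v := by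
  simp [fiber]

/-- A connected fiber has diameter less than its size. -/
lemma within_of_card_fiber_lt [Fintype V] [DecidableEq L] {u v : V} {m : ℕ}
    (h : (H.intra f).Reachable v u) (hm : (fiber f v).card < m) : H.Within m v u := by
  classical
  obtain ⟨p, hp⟩ := h.exists_isPath
  have hsub : p.support.toFinset ⊆ fiber f v := fun w hw =>
    mem_fiber.2 (eq_of_mem_support_intra p (List.mem_toFinset.1 hw))
  have := Finset.card_le_card hsub
  rw [List.toFinset_card_of_nodup hp.support_nodup, Walk.length_support] at this
  exact ⟨p.mapLe intra_le, by rw [Walk.length_map]; omega⟩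

lemma within_mul_of_within {G H : SimpleGraph V} {k r : ℕ} {u v : V}
    (h : ∀ u v, H.Adj u v → G.Within k u v) (huv : H.Within r u v) : G.Within (k * r) u v := by
  induction r generalizing u with
  | zero =>
    rw [within_zero_iff.1 huv]
    exact .refl _ _
  | succ r ih =>
    obtain rfl | ⟨w, hw, h'⟩ := within_succ_iff.1 huv
    · exact .refl _ _
    · exact ((h _ _ hw).trans (ih h')).mono (by rw [Nat.mul_succ, add_comm])

end SimpleGraph

/-- Some element of `S` that depends only on `S`, or `d` if `S` is empty. -/
noncomputable def pick {α : Type*} (S : Set α) (d : α) : α :=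
  open Classical in if h : S.Nonempty then h.some else d

lemma pick_mem {α : Type*} {S : Set α} (h : S.Nonempty) (d : α) : pick S d ∈ S := by
  unfold pick
  rw [dif_pos h]
  exact h.some_mem

lemma pick_of_not_nonempty {α : Type*} {S : Set α} (h : ¬ S.Nonempty) (d : α) : pick S d = d :=
  dif_neg h

namespace SimpleGraph

section Merge

variable {U : Type*} [Fintype U] [DecidableEq U] (H : SimpleGraph U) (f : U → U) (m : ℕ)

/-- The neighbors of the fiber of `v` outside the fiber, if the fiber has less than `m`
elements. -/
def outside (v : U) : Set U :=
  {b | (fiber f v).card < m ∧ ∃ a, f a = f v ∧ H.Adj a b ∧ f b ≠ f v}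

/-- A neighbor of the fiber of `v`, for small fibers that have neighbors, and otherwise `v`. -/
noncomputable def jump (v : U) : U := pick (H.outside f m v) v

/-- The vertices at which fragments are merged: those in large or isolated fragments, and those
in local minima of the coloring `C` to which a fragment of larger color points. -/
def IsStop (C : U → ℕ) (v : U) : Prop :=
  H.jump f m v = v ∨ (C v < C (H.jump f m v) ∧
    ∃ y, H.jump f m y ≠ y ∧ f (H.jump f m y) = f v ∧ C v < C y)

/-- The label of the merged fragment of a vertex. -/
noncomputable def merged (C : U → ℕ) (v : U) : U := f (land (H.jump f m) (H.IsStop f m C) (8 + 8) v)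

variable {H f m}

lemma outside_congr {u v : U} (h : f u = f v) : H.outside f m u = H.outside f m v := by
  simp only [outside, fiber, h]

lemma jump_mem {v : U} (h : H.jump f m v ≠ v) : H.jump f m v ∈ H.outside f m v := by
  by_cases hn : (H.outside f m v).Nonempty
  · exact pick_mem hn v
  · exact absurd (pick_of_not_nonempty hn v) h

lemma jump_ne {v : U} (h : (H.outside f m v).Nonempty) : H.jump f m v ≠ v := by
  obtain ⟨-, -, -, -, h⟩ := pick_mem h v
  exact fun he => h (congrArg f he)

lemma label_jump_ne {v : U} (h : H.jump f m v ≠ v) : f v ≠ f (H.jump f m v) :=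
  let ⟨_, _, _, _, h⟩ := jump_mem h
  h.symm

/-- Pointers belong to fragments although they are defined on vertices: the picked neighbor depends
only on the set `outside`. Only the default value, the vertex itself, varies inside a fragment. -/
lemma jump_congr {u v : U} (h : f u = f v) :
    (H.jump f m u = H.jump f m v ∧ H.jump f m u ≠ u ∧ H.jump f m v ≠ v) ∨
      (H.jump f m u = u ∧ H.jump f m v = v) := by
  by_cases hn : (H.outside f m v).Nonempty
  · have hn' : (H.outside f m u).Nonempty := by rwa [outside_congr h]
    refine .inl ⟨?_, jump_ne hn', jump_ne hn⟩
    rw [jump, jump, outside_congr h, pick, pick, dif_pos hn, dif_pos hn]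
  · have hn' : ¬ (H.outside f m u).Nonempty := by rwa [outside_congr h]
    exact .inr ⟨pick_of_not_nonempty hn' u, pick_of_not_nonempty hn v⟩

lemma reducedColor_congr {C₀ : U → ℕ} (h₀ : ∀ u v, f u = f v → C₀ u = C₀ v) (s : ℕ) {u v : U}
    (h : f u = f v) :
    reducedColor (H.jump f m) C₀ s u = reducedColor (H.jump f m) C₀ s v := by
  induction s generalizing u v with
  | zero => exact h₀ u v h
  | succ s ih =>
    rw [reducedColor, reducedColor, ih h]
    obtain ⟨h', -, -⟩ | ⟨hu, hv⟩ := jump_congr (H := H) (m := m) h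
    · rw [h']
    · rw [hu, hv, ih h]

variable {C : U → ℕ} (hC : ∀ u v, f u = f v → C u = C v)
  (hprop : ∀ v, H.jump f m v ≠ v → C v ≠ C (H.jump f m v)) (hlt : ∀ v, C v < 8)

include hC in
lemma isStop_congr {u v : U} (h : f u = f v) : H.IsStop f m C u ↔ H.IsStop f m C v := by
  obtain ⟨h', hu, hv⟩ | ⟨hu, hv⟩ := jump_congr (H := H) (m := m) h
  · rw [h'] at hu
    simp only [IsStop, hu, hv, false_or, h', hC _ _ h, h]
  · exact iff_of_true (.inl hu) (.inl hv)

include hC in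
lemma label_land_congr (k : ℕ) {u v : U} (h : f u = f v) :
    f (land (H.jump f m) (H.IsStop f m C) k u) = f (land (H.jump f m) (H.IsStop f m C) k v) := by
  induction k generalizing u v with
  | zero => exact h
  | succ k ih =>
    by_cases hv : H.IsStop f m C v
    · rwa [land_of_mem hv, land_of_mem ((isStop_congr hC h).2 hv)]
    · have hu := mt (isStop_congr hC h).1 hv
      rw [land_succ_of_notMem hu, land_succ_of_notMem hv]
      obtain ⟨h', -, -⟩ | ⟨-, hv'⟩ := jump_congr (H := H) (m := m) h
      · rw [h']
      · exact absurd (.inl hv') hv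

include hC in
lemma merged_congr {u v : U} (h : f u = f v) : H.merged f m C u = H.merged f m C v :=
  label_land_congr hC _ h

include hprop hlt in
lemma isStop_land (v : U) : H.IsStop f m C (land (H.jump f m) (H.IsStop f m C) (8 + 8) v) :=
  land_mem hprop (fun _ h => .inl h) (fun v h _ h2 h3 => .inr ⟨h3, v, h, rfl, h2⟩) hlt v

include hprop hlt in
lemma merged_jump {v : U} (h : ¬ H.IsStop f m C v) :
    H.merged f m C (H.jump f m v) = H.merged f m C v := by
  rw [merged, merged, ← land_succ_of_notMem h, land_succ_eq (isStop_land hprop hlt v)]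

lemma merged_of_isStop {v : U} (h : H.IsStop f m C v) : H.merged f m C v = f v := by
  rw [merged, land_of_mem h]

variable (hconn : ∀ u v, f u = f v → (H.intra f).Reachable u v)

include hC in
lemma intra_le_intra_merged : H.intra f ≤ H.intra (H.merged f m C) :=
  fun _ _ h => ⟨h.1, merged_congr hC h.2⟩

-- Each step runs inside a fragment and then along one edge; both stay in the merged fragment, since
-- a pointer that is followed leads to the same landing point.
include hC hprop hlt hconn in
lemma reachable_land (k : ℕ) (v : U) : (H.intra (H.merged f m C)).Reachable v
    (land (H.jump f m) (H.IsStop f m C) k v) := by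
  induction k generalizing v with
  | zero => rfl
  | succ k ih =>
    by_cases hv : H.IsStop f m C v
    · rw [land_of_mem hv]
    · rw [land_succ_of_notMem hv]
      refine .trans ?_ (ih _)
      obtain ⟨-, a, ha, hadj, -⟩ := jump_mem (H := H) (f := f) (m := m) fun h => hv (.inl h)
      refine ((hconn v a ha.symm).mono (intra_le_intra_merged hC)).trans ?_
      refine SimpleGraph.Adj.reachable ⟨hadj, ?_⟩
      rw [merged_jump hprop hlt hv, merged_congr hC ha]

include hC hprop hlt hconn in
lemma reachable_merged {u v : U} (h : H.merged f m C u = H.merged f m C v) :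
    (H.intra (H.merged f m C)).Reachable u v :=
  (reachable_land hC hprop hlt hconn _ u).trans <|
    ((hconn _ _ h).mono (intra_le_intra_merged hC)).trans
      (reachable_land hC hprop hlt hconn _ v).symm

include hC in
lemma card_fiber_le_merged {u w : U} (h : H.merged f m C w = H.merged f m C u) :
    (fiber f w).card ≤ (fiber (H.merged f m C) u).card :=
  Finset.card_le_card fun _ hx => mem_fiber.2 ((merged_congr hC (mem_fiber.1 hx)).trans h)

variable {θ : ℕ} (hcard : ∀ u v, H.Adj u v → f u ≠ f v → θ ≤ (fiber f u).card)

include hcard in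
lemma le_card_of_jump_ne {v : U} (h : H.jump f m v ≠ v) : θ ≤ (fiber f v).card := by
  obtain ⟨-, a, ha, hadj, hne⟩ := jump_mem h
  have := hcard a _ hadj (by rw [ha]; exact hne.symm)
  simpa only [fiber, ha] using this

include hC hprop hlt hcard in
/-- Merging doubles the size of the fragments that are not components. -/
lemma le_card_fiber_merged (hm : m ≤ 2 * θ) {u v : U} (huv : H.Adj u v)
    (hne : H.merged f m C u ≠ H.merged f m C v) : m ≤ (fiber (H.merged f m C) u).card := by
  by_cases hu : m ≤ (fiber f u).card
  · exact hu.trans (card_fiber_le_merged hC rfl)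
  push Not at hu
  have hju : H.jump f m u ≠ u :=
    jump_ne ⟨v, hu, u, rfl, huv, fun h => hne (merged_congr hC h.symm)⟩
  obtain ⟨w, hw⟩ : ∃ w, land (H.jump f m) (H.IsStop f m C) (8 + 8) u = w := ⟨_, rfl⟩
  have hwA : H.IsStop f m C w := hw ▸ isStop_land hprop hlt u
  have hmw : H.merged f m C w = H.merged f m C u := by
    rw [merged_of_isStop hwA, merged, hw]
  -- A landing point without a pointer is large: it was entered along an edge from another fragment,
  -- so a small one would have an outside neighbor to point to.
  by_cases hwfix : H.jump f m w = w
  · refine le_trans ?_ (card_fiber_le_merged hC hmw)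
    by_contra hlt'
    push Not at hlt'
    obtain h | ⟨y, hy, hyne⟩ :=
      land_eq_or_exists (A := H.IsStop f m C) (fun v h => .inl h) (8 + 8) u
    · exact hju (h ▸ (hw ▸ hwfix))
    · rw [hw] at hy
      obtain ⟨-, a, ha, hadj, hne'⟩ := jump_mem hyne
      rw [← hy] at hadj hne'
      exact jump_ne ⟨a, hlt', w, rfl, hadj.symm, by rw [ha]; exact hne'.symm⟩ hwfix
  -- At a local minimum, `y` points to the fragment of `w` from a larger color. Hence `y` is no stop
  -- and is merged too, and the two disjoint fragments have at least `θ` vertices each.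
  · obtain ⟨-, y, hy, hyw, hCy⟩ := hwA.resolve_left hwfix
    have hyns : ¬ H.IsStop f m C y := by
      rintro (h | ⟨h, -⟩)
      · exact hy h
      · rw [hC _ _ hyw] at h
        omega
    have hmy : H.merged f m C y = H.merged f m C u := by
      rw [← merged_jump hprop hlt hyns, merged_congr hC hyw, hmw]
    have hdisj : Disjoint (fiber f w) (fiber f y) := by
      rw [Finset.disjoint_left]
      intro x hx hx'
      have := hC _ _ ((mem_fiber.1 hx).symm.trans (mem_fiber.1 hx'))
      omega
    calc m ≤ (fiber f w).card + (fiber f y).card := by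
          have := le_card_of_jump_ne hcard hwfix
          have := le_card_of_jump_ne hcard hy
          omega
      _ = (fiber f w ∪ fiber f y).card := (Finset.card_union_of_disjoint hdisj).symm
      _ ≤ _ := Finset.card_le_card fun _ hx => by
          rw [Finset.mem_union, mem_fiber, mem_fiber] at hx
          rw [mem_fiber]
          obtain hx | hx := hx
          · rw [merged_congr hC hx, hmw]
          · rw [merged_congr hC hx, hmy]

include hconn in
lemma within_jump {G : SimpleGraph U} (hG : ∀ u v, H.Adj u v → G.Within 2 u v) (v : U) :
    G.Within (2 * m + 2) v (H.jump f m v) := by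
  by_cases h : H.jump f m v = v
  · rw [h]
    exact .refl _ _
  · obtain ⟨hm, a, ha, hadj, -⟩ := jump_mem h
    exact (within_mul_of_within hG (within_of_card_fiber_lt (hconn _ _ ha.symm) hm)).trans
      (hG _ _ hadj)

include hconn in
lemma within_land {G : SimpleGraph U} (hG : ∀ u v, H.Adj u v → G.Within 2 u v) (A : U → Prop)
    (k : ℕ) (v : U) : G.Within (k * (2 * m + 2)) v (land (H.jump f m) A k v) := by
  induction k generalizing v with
  | zero => exact .refl _ _
  | succ k ih =>
    by_cases hv : A v
    · rw [land_of_mem hv]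
      exact .refl _ _
    · rw [land_succ_of_notMem hv]
      exact ((within_jump hconn hG v).trans (ih _)).mono (by linarith)

end Merge

end SimpleGraph

/-! ### Locality of merging, and fragments of size `2 ^ k` -/

namespace LabeledGraph

open SimpleGraph

variable {N : ℕ} {In : Type}

/-- The graphs `H I` connect vertices at distance at most `2`, and the neighbors of a vertex can be
determined within distance `2`. -/
structure LocallyDefined (H : LabeledGraph N In → SimpleGraph (Fin N)) : Prop where
  within : ∀ (I : LabeledGraph N In) u v, (H I).Adj u v → I.graph.Within 2 u v
  isLocal : IsLocal (fun I => (H I).neighborSet) 2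

/-- A partition into fragments, the fibers of `f I`, that can be computed within distance `T`.
Fragments are connected in `H I` and labeled by a vertex within distance `R`; they have at least
`θ` vertices unless they are isolated. -/
structure Fragmentation (H : LabeledGraph N In → SimpleGraph (Fin N))
    (f : LabeledGraph N In → Fin N → Fin N) (θ R T : ℕ) : Prop where
  isLocal : IsLocal f T
  reachable : ∀ I u v, f I u = f I v → ((H I).intra (f I)).Reachable u v
  within : ∀ (I : LabeledGraph N In) v, I.graph.Within R v (f I v)
  card : ∀ I u v, (H I).Adj u v → f I u ≠ f I v → θ ≤ (fiber (f I) u).card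

variable {H : LabeledGraph N In → SimpleGraph (Fin N)} {f : LabeledGraph N In → Fin N → Fin N}
  {θ R T m : ℕ} {I J : LabeledGraph N In} {v : Fin N}

lemma LocallyDefined.adj_iff (hH : LocallyDefined H) (h : Agree I J 2 v) (u : Fin N) :
    (H I).Adj v u ↔ (H J).Adj v u := by
  have h' : (H I).neighborSet v = (H J).neighborSet v := hH.isLocal I J v h
  rw [← mem_neighborSet, h', mem_neighborSet]

namespace Fragmentation

lemma within_of_small (hH : LocallyDefined H) (hf : Fragmentation H f θ R T)
    (hm : (fiber (f I) v).card < m) {u : Fin N} (hu : f I u = f I v) :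
    I.graph.Within (2 * m) v u :=
  within_mul_of_within (hH.within I) (within_of_card_fiber_lt (hf.reachable I _ _ hu.symm) hm)

/-- A vertex of the fiber in `J` could be far away a priori. It is reached by a walk inside that
fiber, and induction along the walk keeps every vertex in the small fiber of `I`, where the two
graphs agree; the 2 beyond `2 * m` pays for the next edge. -/
lemma fiber_eq (hH : LocallyDefined H) (hf : Fragmentation H f θ R T)
    (h : Agree I J (T + (2 * m + 2)) v) (hm : (fiber (f I) v).card < m) :
    fiber (f I) v = fiber (f J) v := by
  have hv := hf.isLocal I J v (h.mono (by omega))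
  ext u
  rw [mem_fiber, mem_fiber]
  constructor
  · intro hu
    have hw := hf.within_of_small hH hm hu
    rw [← hf.isLocal I J u (h.of_within hw (by omega)), hu, hv]
  · intro hu
    obtain ⟨p⟩ := hf.reachable J u v hu
    induction p with
    | nil => rfl
    | @cons u w _ hadj q ih =>
      have hw := ih h hm hv (hadj.2.symm.trans hu)
      have hww := hf.within_of_small hH hm hw
      have hadj' := (hH.adj_iff (h.of_within hww (by omega)) u).2 hadj.1.symm
      have hu' := hf.isLocal I J u
        (h.of_within (hww.trans (hH.within I _ _ hadj')) (by omega))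
      rw [hu', hu, hv]

lemma outside_subset (hH : LocallyDefined H) (hf : Fragmentation H f θ R T)
    (h : Agree I J (T + (2 * m + 2)) v) :
    (H I).outside (f I) m v ⊆ (H J).outside (f J) m v := by
  rintro b ⟨hm, a, ha, hadj, hb⟩
  have hv := hf.isLocal I J v (h.mono (by omega))
  have hw := hf.within_of_small hH hm ha
  have hwb := hw.trans (hH.within I _ _ hadj)
  have ha' := hf.isLocal I J a (h.of_within hw (by omega))
  have hb' := hf.isLocal I J b (h.of_within hwb (by omega))
  refine ⟨?_, a, ?_, (hH.adj_iff (h.of_within hw (by omega)) b).1 hadj, ?_⟩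
  · rwa [← hf.fiber_eq hH h hm]
  · rw [← ha', ha, hv]
  · rwa [← hb', ← hv]

lemma isLocal_jump (hH : LocallyDefined H) (hf : Fragmentation H f θ R T) (m : ℕ) :
    IsLocal (fun I => (H I).jump (f I) m) (T + (2 * m + 2)) := by
  intro I J v h
  simp only [jump]
  rw [(hf.outside_subset hH h).antisymm (hf.outside_subset hH h.symm)]

variable (H f m) in
/-- The colors that are used for merging the fragments. -/
noncomputable def color (I : LabeledGraph N In) (s : ℕ) : Fin N → ℕ :=
  reducedColor ((H I).jump (f I) m) (fun v => f I v) s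

lemma isLocal_color (hH : LocallyDefined H) (hf : Fragmentation H f θ R T) (m s : ℕ) :
    IsLocal (fun I => color H f m I s) (T + s * (2 * m + 2)) := by
  induction s with
  | zero => exact (hf.isLocal.map Fin.val).mono (by omega)
  | succ s ih =>
    have h2 := ih.comp (hf.isLocal_jump hH m)
      (fun I => within_jump (hf.reachable I) (hH.within I)) (by omega)
    exact ((ih.mono (by omega)).map₂ h2 coleVishkin).mono (by linarith)

lemma isStop_of_agree (hH : LocallyDefined H) (hf : Fragmentation H f θ R T) {s : ℕ}
    (h : Agree I J (T + (s + 3) * (2 * m + 2)) v)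
    (hI : (H I).IsStop (f I) m (color H f m I s) v) :
    (H J).IsStop (f J) m (color H f m J s) v := by
  have hs : T + (s + 3) * (2 * m + 2) = T + s * (2 * m + 2) + 3 * (2 * m + 2) := by ring
  rw [hs] at h
  have hjv := hf.isLocal_jump hH m I J v (h.mono (by omega))
  by_cases hfix : (H I).jump (f I) m v = v
  · exact .inl (hjv.symm.trans hfix)
  obtain ⟨hlt, y, hy, hfy, hCy⟩ := hI.resolve_left hfix
  have hv := hf.isLocal I J v (h.mono (by omega))
  have hwv := within_jump (m := m) (hf.reachable I) (hH.within I) v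
  -- Only small fragments have pointers, so the target of `y` is within `2 * m` of `v` and `y` is
  -- within `4 * m + 2`. This accounts for the 3 in `s + 3`.
  have hwj := hf.within_of_small hH (jump_mem hfix).1 hfy
  have hwy := hwj.trans (within_jump (m := m) (hf.reachable I) (hH.within I) y).symm
  have hCv := hf.isLocal_color hH m s I J v (h.mono (by omega))
  have hCj := hf.isLocal_color hH m s I J _ (h.of_within hwv (by omega))
  have hCy' := hf.isLocal_color hH m s I J _ (h.of_within hwy (by omega))
  have hjy := hf.isLocal_jump hH m I J y (h.of_within hwy (by omega))
  have hfj := hf.isLocal I J _ (h.of_within hwj (by omega))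
  simp only at hjv hCv hCj hCy' hjy hfj
  refine .inr ⟨?_, y, ?_, ?_, ?_⟩
  · rwa [← hjv, ← hCv, ← hCj]
  · rwa [← hjy]
  · rwa [← hjy, ← hfj, ← hv]
  · rwa [← hCv, ← hCy']

lemma isLocal_isStop (hH : LocallyDefined H) (hf : Fragmentation H f θ R T) (m s : ℕ) :
    IsLocal (fun I => (H I).IsStop (f I) m (color H f m I s)) (T + (s + 3) * (2 * m + 2)) :=
  fun _ _ _ h => propext ⟨hf.isStop_of_agree hH h, hf.isStop_of_agree hH h.symm⟩

lemma isLocal_land (hH : LocallyDefined H) (hf : Fragmentation H f θ R T) (m s k : ℕ) :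
    IsLocal (fun I => land ((H I).jump (f I) m) ((H I).IsStop (f I) m (color H f m I s)) k)
      (T + (s + 3 + k) * (2 * m + 2)) := by
  induction k with
  | zero => exact fun _ _ _ _ => rfl
  | succ k ih =>
    classical
    have hk : T + (s + 3 + (k + 1)) * (2 * m + 2) =
        T + (s + 3 + k) * (2 * m + 2) + (2 * m + 2) := by ring
    have h2 := ih.comp (hf.isLocal_jump hH m)
      (fun I => within_jump (hf.reachable I) (hH.within I)) (by nlinarith)
    rw [hk]
    intro I J v h
    have hst := hf.isLocal_isStop hH m s I J v (h.mono (by nlinarith))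
    have := h2 I J v h
    simp only at hst this
    simp only [land, hst, this]

lemma isLocal_merged (hH : LocallyDefined H) (hf : Fragmentation H f θ R T) (m s : ℕ) :
    IsLocal (fun I => (H I).merged (f I) m (color H f m I s))
      (T + (s + 35) * (2 * m + 2)) := by
  have h1 := hf.isLocal_land hH m s (8 + 8)
  -- Here 35 = 3 + 16 + 16: the stop condition, the 16 steps of landing, and the distance to the
  -- landing point at which the label is read.
  refine IsLocal.mono ((hf.isLocal.mono (T' := T + (s + 19) * (2 * m + 2)) (by nlinarith)).comp h1
    (r := (8 + 8) * (2 * m + 2)) (fun I => within_land (hf.reachable I) (hH.within I) _ _)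
    (by nlinarith)) (by nlinarith)

/-- One phase of merging doubles the size of fragments. -/
theorem exists_double (hH : LocallyDefined H) (hf : Fragmentation H f θ R T) (hθ : 1 ≤ θ) :
    ∃ f', Fragmentation H f' (2 * θ) (R + 96 * θ) (T + 210 * (logStar N + 1) * θ) ∧
      ∀ I u v, f I u = f I v → f' I u = f' I v := by
  set s := logStar N
  have h0 (I u v) (h : f I u = f I v) : color H f (2 * θ) I s u = color H f (2 * θ) I s v :=
    reducedColor_congr (fun u v h => congrArg Fin.val h) s h
  have h1 (I v) (h : (H I).jump (f I) (2 * θ) v ≠ v) : color H f (2 * θ) I s v ≠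
      color H f (2 * θ) I s ((H I).jump (f I) (2 * θ) v) :=
    reducedColor_ne (fun v h he => label_jump_ne h (Fin.ext he)) s h
  have h2 (I v) : color H f (2 * θ) I s v < 8 := reducedColor_lt_eight (fun v => (f I v).2) v
  refine ⟨fun I => (H I).merged (f I) (2 * θ) (color H f (2 * θ) I s), ⟨?_, ?_, ?_, ?_⟩, ?_⟩
  -- With `m = 2 * θ` and `1 ≤ θ`, one jump costs `2 * m + 2 ≤ 6 * θ`. This yields `(s + 35) * 6 ≤
  -- 210 * (s + 1)` here and `16 * 6 = 96` for the radius.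
  · exact (hf.isLocal_merged hH (2 * θ) s).mono (by nlinarith)
  · exact fun I u v h => reachable_merged (h0 I) (h1 I) (h2 I) (hf.reachable I) h
  · intro I v
    exact ((within_land (hf.reachable I) (hH.within I) _ _ v).trans (hf.within I _)).mono
      (by omega)
  · exact fun I u v => le_card_fiber_merged (h0 I) (h1 I) (h2 I) (hf.card I) le_rfl
  · exact fun I u v => merged_congr (h0 I)

/-- Fragments of size `2 ^ k` are obtained by `k` phases of merging. -/
theorem exists_pow (hH : LocallyDefined H) (hf : Fragmentation H f 1 R T) (k : ℕ) :
    ∃ f', Fragmentation H f' (2 ^ k) (R + 96 * 2 ^ k) (T + 210 * (logStar N + 1) * 2 ^ k) ∧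
      ∀ I u v, f I u = f I v → f' I u = f' I v := by
  induction k with
  | zero =>
    refine ⟨f, ⟨hf.isLocal.mono (by omega), hf.reachable, fun I v => (hf.within I v).mono ?_,
      hf.card⟩, fun _ _ _ h => h⟩
    omega
  | succ k ih =>
    obtain ⟨f₁, hf₁, h₁⟩ := ih
    obtain ⟨f₂, hf₂, h₂⟩ := hf₁.exists_double hH Nat.one_le_two_pow
    refine ⟨f₂, ?_, fun I u v h => h₂ I u v (h₁ I u v h)⟩
    -- The cost of a phase equals the bound for all earlier phases, so the bound doubles exactly.
    convert hf₂ using 1 <;> ring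

end Fragmentation

lemma fragmentation_id (H : LabeledGraph N In → SimpleGraph (Fin N)) :
    Fragmentation H (fun _ v => v) 1 0 0 where
  isLocal _ _ _ _ := rfl
  reachable _ _ _ h := h ▸ .rfl
  within _ _ := .refl _ _
  card _ u _ _ _ := Finset.card_pos.2 ⟨u, mem_fiber.2 rfl⟩

/-- Changing the graph that the fragments refer to. -/
lemma Fragmentation.change {H H' : LabeledGraph N In → SimpleGraph (Fin N)}
    (hf : Fragmentation H f θ R T) (h : ∀ I, H I ≤ H' I) : Fragmentation H' f 1 R T where
  isLocal := hf.isLocal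
  reachable I u v huv := (hf.reachable I u v huv).mono (intra_mono (h I))
  within := hf.within
  card _ u _ _ _ := Finset.card_pos.2 ⟨u, mem_fiber.2 rfl⟩

end LabeledGraph

/-! ### Counting edges between fragments of a cactus -/

namespace SimpleGraph

section

variable {V L : Type*} {H : SimpleGraph V} {f : V → L}

/-- The graph of the edges of `H` inside the fibers of `f` and of the edges in `F`. -/
def intraSup (H : SimpleGraph V) (f : V → L) (F : Set (Sym2 V)) : SimpleGraph V where
  Adj u v := H.Adj u v ∧ (f u = f v ∨ s(u, v) ∈ F)
  symm := ⟨fun u v h => ⟨h.1.symm, h.2.imp Eq.symm fun h => by rwa [Sym2.eq_swap]⟩⟩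
  loopless := ⟨fun _ h => h.1.ne rfl⟩

lemma intraSup_le (F : Set (Sym2 V)) : H.intraSup f F ≤ H := fun _ _ h => h.1

lemma intra_le_intraSup (F : Set (Sym2 V)) : H.intra f ≤ H.intraSup f F :=
  fun _ _ h => ⟨h.1, .inl h.2⟩

/-- A walk between different fibers uses an edge of `F`. -/
lemma exists_mem_edges_intraSup {F : Set (Sym2 V)} {u v : V} (p : (H.intraSup f F).Walk u v)
    (h : f u ≠ f v) : ∃ e ∈ p.edges, e ∈ F := by
  induction p with
  | nil => exact absurd rfl h
  | @cons a b c hadj q ih =>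
    by_cases hab : f a = f b
    · obtain ⟨e, he, heF⟩ := ih (hab ▸ h)
      exact ⟨e, by simp [he], heF⟩
    · exact ⟨s(a, b), by simp, hadj.2.resolve_left hab⟩

/-- A root of the connected component of a vertex. -/
noncomputable def root (H : SimpleGraph V) (v : V) : V := (H.connectedComponentMk v).out

lemma reachable_root (v : V) : H.Reachable v (H.root v) := by
  rw [← ConnectedComponent.eq]
  exact (Quot.out_eq _).symm

lemma root_eq {u v : V} (h : H.Reachable u v) : H.root u = H.root v := by
  unfold root
  rw [ConnectedComponent.eq.2 h]

end

variable {V L : Type*} [Fintype V] [DecidableEq L] {H : SimpleGraph V} {f : V → L} {t : ℕ}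

/-- There are few edges that connect all fibers in the same component. -/
lemma exists_connecting_edges (hconn : ∀ u v, f u = f v → (H.intra f).Reachable u v)
    (ht : ∀ u v, H.Adj u v → f u ≠ f v → t ≤ (fiber f u).card) :
    ∃ F : Finset (Sym2 V), t * F.card ≤ Fintype.card V ∧
      ∀ u v, H.Reachable u v → (H.intraSup f F).Reachable u v := by
  classical
  obtain hV | hV := isEmpty_or_nonempty V
  · exact ⟨∅, by simp, fun u => isEmptyElim u⟩
  -- A fiber that avoids its root receives the first edge of a shortest path from its vertex nearest
  -- to the root. That edge enters a fiber closer to the root, so induction on `d` connects every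
  -- vertex to its root.
  let d (v : V) : ℕ := H.dist v (H.root v)
  have hex (l : L) : ∃ e : Sym2 V,
      (∃ v, f v = l ∧ (∀ u, f u = l → d v ≤ d u) ∧ d v ≠ 0) →
      ∃ v p, e = s(v, p) ∧ f v = l ∧ H.Adj v p ∧ f v ≠ f p ∧ ∀ u, f u = l → d p < d u := by
    by_cases h : ∃ v, f v = l ∧ (∀ u, f u = l → d v ≤ d u) ∧ d v ≠ 0
    · obtain ⟨v, hv, hmin, h0⟩ := h
      obtain ⟨p, hadj, hlt⟩ : ∃ p, H.Adj v p ∧ d p < d v := by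
        obtain ⟨w, hw⟩ := (reachable_root (H := H) v).exists_walk_length_eq_dist
        change w.length = d v at hw
        generalize hr : H.root v = r at w hw
        cases w with
        | nil => exact absurd hw.symm h0
        | @cons _ p _ hadj q =>
          refine ⟨p, hadj, ?_⟩
          have hpr : H.root p = r := by rw [← root_eq hadj.reachable, hr]
          have := dist_le q
          rw [← hw, Walk.length_cons]
          simp only [d, hpr]
          omega
      refine ⟨s(v, p), fun _ => ⟨v, p, rfl, hv, hadj, fun h => ?_, fun u hu => ?_⟩⟩
      · exact (hmin p (h.symm.trans hv)).not_gt hlt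
      · exact hlt.trans_le (hmin u hu)
    · exact ⟨s(hV.some, hV.some), fun h' => absurd h' h⟩
  choose pe hpe using hex
  -- Edges are needed only for fibers that have crossing edges, and these have size at least `t`.
  -- Other labels in `B` carry a harmless default edge, and `t * B.card` is at most the number of
  -- vertices.
  let B : Finset L := (Finset.univ.image f).filter
    fun l => t ≤ (Finset.univ.filter fun u => f u = l).card
  refine ⟨B.image pe, ?_, ?_⟩
  · calc t * (B.image pe).card ≤ t * B.card := Nat.mul_le_mul_left _ Finset.card_image_le
      _ = B.card • t := by rw [smul_eq_mul, mul_comm]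
      _ ≤ ∑ l ∈ B, (Finset.univ.filter fun u => f u = l).card :=
          Finset.card_nsmul_le_sum _ _ _ fun l hl => (Finset.mem_filter.1 hl).2
      _ ≤ ∑ l ∈ Finset.univ.image f, (Finset.univ.filter fun u => f u = l).card :=
          Finset.sum_le_sum_of_subset (Finset.filter_subset _ _)
      _ = Fintype.card V := (Finset.card_eq_sum_card_image f Finset.univ).symm
  · have key (n : ℕ) : ∀ v, d v = n →
        (H.intraSup f (B.image pe)).Reachable v (H.root v) := by
      induction n using Nat.strong_induction_on with
      | _ n ih =>
        intro v hn
        obtain ⟨m, hm, hmin⟩ := Finset.exists_min_image (fiber f v) d ⟨v, mem_fiber.2 rfl⟩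
        rw [mem_fiber] at hm
        simp only [mem_fiber] at hmin
        have hin {u : V} (hu : f u = f v) : (H.intraSup f (B.image pe)).Reachable v u :=
          (hconn v u hu.symm).mono (intra_le_intraSup _)
        have hroot {u : V} (hu : f u = f v) : H.root u = H.root v :=
          (root_eq ((hin hu).mono (intraSup_le _))).symm
        by_cases h0 : d m = 0
        · have : m = H.root m := (reachable_root m).dist_eq_zero_iff.1 h0
          rw [← hroot hm, ← this]
          exact hin hm
        · obtain ⟨a, p, he, ha, hadj, hne, hlt⟩ := hpe (f v) ⟨m, hm, hmin, h0⟩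
          have hlt' := hlt v rfl
          have hp := ih _ (hn ▸ hlt') p rfl
          have hB : f v ∈ B := by
            refine Finset.mem_filter.2 ⟨Finset.mem_image_of_mem _ (Finset.mem_univ _), ?_⟩
            have := ht a p hadj hne
            simpa only [fiber, ha] using this
          have hap : (H.intraSup f (B.image pe)).Adj a p :=
            ⟨hadj, .inr (Finset.mem_coe.2 (he ▸ Finset.mem_image_of_mem _ hB))⟩
          rw [← root_eq hadj.reachable, hroot ha] at hp
          exact (hin ha).trans (hap.reachable.trans hp)
    intro u v h
    refine (key _ u rfl).trans ?_
    rw [root_eq h]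
    exact (key _ v rfl).symm

/-- If a cactus is partitioned into connected fibers, of which those that are not components have
at least `t` vertices, then there are few edges between them. -/
lemma card_crossing_le (hcactus : H.IsCactus)
    (hconn : ∀ u v, f u = f v → (H.intra f).Reachable u v)
    (ht : ∀ u v, H.Adj u v → f u ≠ f v → t ≤ (fiber f u).card) (E : Finset (Sym2 V))
    (hE : ∀ e ∈ E, ∃ u v, e = s(u, v) ∧ H.Adj u v ∧ f u ≠ f v) :
    t * E.card ≤ 2 * Fintype.card V := by
  classical
  obtain ⟨F, hF, hreach⟩ := exists_connecting_edges hconn ht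
  -- A path between the ends of `e` in `intraSup` closes a cycle with `e`; since the ends lie in
  -- different fibers, it must use an edge of `F`.
  have hex (e : Sym2 V) (he : e ∈ E \ F) : ∃ e' ∈ F, ∃ (w : V) (c : H.Walk w w), c.IsCycle ∧
      e ∈ c.edges ∧ e' ∈ c.edges ∧ ∀ x ∈ c.edges, x = e ∨ x ∈ (H.intraSup f F).edgeSet := by
    rw [Finset.mem_sdiff] at he
    obtain ⟨u, v, rfl, hadj, hne⟩ := hE e he.1
    obtain ⟨p, hp⟩ := (hreach v u hadj.symm.reachable).exists_isPath
    obtain ⟨e', he', heF⟩ := exists_mem_edges_intraSup p hne.symm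
    have hedges : (p.mapLe (intraSup_le _)).edges = p.edges := by simp
    refine ⟨e', heF, u, .cons hadj (p.mapLe (intraSup_le _)), ?_, by simp, ?_, ?_⟩
    · rw [Walk.cons_isCycle_iff, hedges]
      refine ⟨hp.mapLe _, fun h => ?_⟩
      exact (p.edges_subset_edgeSet h).2.elim hne fun h => he.2 (Finset.mem_coe.1 h)
    · rw [Walk.edges_cons, hedges]
      exact List.mem_cons_of_mem _ he'
    · intro x hx
      rw [Walk.edges_cons, hedges, List.mem_cons] at hx
      exact hx.imp_right fun h => p.edges_subset_edgeSet h
  choose! φ hφF hφ using hex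
  have hcard : (E \ F).card ≤ F.card := by
    refine Finset.card_le_card_of_injOn φ hφF fun e he e' he' heq => ?_
    obtain ⟨w, c, hc, hec, hφc, -⟩ := hφ e he
    obtain ⟨w', c', hc', -, hφc', hall⟩ := hφ e' he'
    -- If `e` and `e'` share an `F`-edge, their cycles coincide. The cycle of `e'` leaves `intraSup`
    -- only at `e'`, while `e` is not in `intraSup`, so `e = e'`.
    have := (hcactus (φ e) _ _ c c' hc hc' hφc (heq ▸ hφc') e).1 hec
    refine (hall e this).resolve_right fun h => ?_
    rw [Finset.mem_coe, Finset.mem_sdiff] at he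
    obtain ⟨u, v, rfl, -, hne⟩ := hE e he.1
    exact h.2.elim hne fun h => he.2 (Finset.mem_coe.1 h)
  have hle : E.card ≤ (E \ F).card + F.card := by
    rw [← Finset.card_union_of_disjoint Finset.sdiff_disjoint]
    exact Finset.card_le_card fun x hx => by
      rw [Finset.mem_union, Finset.mem_sdiff]
      tauto
  nlinarith

/-- The vertices that are the smaller endpoint of an edge between fibers are few. -/
lemma card_lower_endpoints_le {M : Type*} [LinearOrder M] (hcactus : H.IsCactus)
    (hconn : ∀ u v, f u = f v → (H.intra f).Reachable u v)
    (ht : ∀ u v, H.Adj u v → f u ≠ f v → t ≤ (fiber f u).card) (key : V → M) (S : Finset V)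
    (hS : ∀ v ∈ S, ∃ u, H.Adj v u ∧ f v ≠ f u ∧ key v < key u) :
    t * S.card ≤ 2 * Fintype.card V := by
  classical
  choose! g hadj hne hlt using hS
  -- Injective because an edge has only one endpoint with the smaller key.
  rw [← Finset.card_image_of_injOn (f := fun v => s(v, g v))]
  · refine card_crossing_le hcactus hconn ht _ fun e he => ?_
    obtain ⟨v, hv, rfl⟩ := Finset.mem_image.1 he
    exact ⟨v, g v, rfl, hadj v hv, hne v hv⟩
  · intro v hv w hw h
    obtain h | ⟨h1, h2⟩ := by simpa [Sym2.eq_iff] using h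
    · exact h.1
    · have h3 := hlt v hv
      have h4 := hlt w hw
      rw [h2] at h3
      rw [← h1] at h4
      exact absurd h3 h4.not_gt

end SimpleGraph

/-! ### Transfer along embeddings, and the number of clusters -/

namespace SimpleGraph

variable {V U L : Type*} {G : SimpleGraph V} {e : V ↪ U} {f : U → L}

/-- Walks in the image of a graph under an embedding can be lifted. -/
lemma exists_lift_walk {v : V} {j k : U} (p : (G.map e).Walk j k) (hj : j = e v) :
    ∃ u, k = e u ∧ ∃ q : G.Walk v u, p.support = q.support.map e := by
  induction p generalizing v with
  | nil => exact ⟨v, hj, .nil, by simp [hj]⟩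
  | cons hadj p ih =>
    subst hj
    obtain ⟨v', w, h, hv, rfl⟩ := (map_adj _ _ _ _).1 hadj
    obtain rfl := e.injective hv
    obtain ⟨u, hu, q, hq⟩ := ih rfl
    exact ⟨u, hu, .cons h q, by simp [hq]⟩

lemma intra_map : (G.map e).intra f = (G.intra (f ∘ e)).map e := by
  ext j k
  simp only [intra, map_adj, Function.comp]
  constructor
  · rintro ⟨⟨u, v, h, rfl, rfl⟩, hf⟩
    exact ⟨u, v, ⟨h, hf⟩, rfl, rfl⟩
  · rintro ⟨u, v, ⟨h, hf⟩, rfl, rfl⟩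
    exact ⟨⟨u, v, h, rfl, rfl⟩, hf⟩

lemma exists_of_reachable_intra_map {v : V} {k : U} (h : ((G.map e).intra f).Reachable (e v) k) :
    ∃ u, k = e u ∧ (G.intra (f ∘ e)).Reachable v u := by
  rw [intra_map] at h
  obtain ⟨p⟩ := h
  obtain ⟨u, hu, q, -⟩ := exists_lift_walk p rfl
  exact ⟨u, hu, ⟨q⟩⟩

variable (hconn : ∀ j k, f j = f k → ((G.map e).intra f).Reachable j k)

include hconn in
lemma reachable_intra_comp (u v : V) (h : (f ∘ e) u = (f ∘ e) v) :
    (G.intra (f ∘ e)).Reachable u v := by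
  obtain ⟨w, hw, h⟩ := exists_of_reachable_intra_map (hconn _ _ h)
  rwa [e.injective hw]

-- A connected fiber that meets the image of `e` stays in it, so restricting to `V` loses no
-- vertices of the fiber.
include hconn in
lemma le_card_fiber_comp [Fintype V] [Fintype U] [DecidableEq L] {t : ℕ}
    (hcard : ∀ j k, (G.map e).Adj j k → f j ≠ f k → t ≤ (fiber f j).card) (u v : V)
    (huv : G.Adj u v) (hne : (f ∘ e) u ≠ (f ∘ e) v) : t ≤ (fiber (f ∘ e) u).card := by
  refine (hcard _ _ ((map_adj_apply).2 huv) hne).trans ?_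
  rw [← Finset.card_map e]
  refine Finset.card_le_card fun k hk => ?_
  obtain ⟨w, rfl, -⟩ := exists_of_reachable_intra_map (hconn _ _ (mem_fiber.1 hk).symm)
  have hw := mem_fiber.1 hk
  exact Finset.mem_map_of_mem _ (mem_fiber.2 hw)

/-- In a connected graph, a partition into at least two connected parts has crossing edges at each
part. -/
lemma mul_card_labels_le [Fintype V] [DecidableEq L] {f : V → L} (hG : G.Preconnected) {t : ℕ}
    (ht : ∀ u v, G.Adj u v → f u ≠ f v → t ≤ (fiber f u).card)
    (h2 : ∃ u v, f u ≠ f v) : t * (Finset.univ.image f).card ≤ Fintype.card V := by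
  classical
  have hle (v : V) : t ≤ (fiber f v).card := by
    obtain ⟨u, hu⟩ : ∃ u, f v ≠ f u := by
      by_contra! h
      obtain ⟨a, b, hab⟩ := h2
      exact hab ((h a).symm.trans (h b))
    obtain ⟨p⟩ := hG v u
    obtain ⟨d, hd, h1, h2⟩ := p.exists_boundary_dart {w | f w = f v} rfl fun h => hu h.symm
    have h1 : f d.fst = f v := h1
    have := ht _ _ d.adj fun h => h2 (h.symm.trans h1)
    simpa only [fiber, h1] using this
  calc t * (Finset.univ.image f).card = (Finset.univ.image f).card • t := by
        rw [smul_eq_mul, mul_comm]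
    _ ≤ ∑ l ∈ Finset.univ.image f, (Finset.univ.filter fun u => f u = l).card := by
        refine Finset.card_nsmul_le_sum _ _ _ fun l hl => ?_
        obtain ⟨v, -, rfl⟩ := Finset.mem_image.1 hl
        exact hle v
    _ = Fintype.card V := (Finset.card_eq_sum_card_image f Finset.univ).symm

/-- The graph on `A` that connects vertices at distance at most `2` in `G`. -/
def squareInduce (G : SimpleGraph V) (A : Set V) : SimpleGraph A where
  Adj u v := u ≠ v ∧ (G.Adj u v ∨ ∃ w, G.Adj u w ∧ G.Adj w v)
  symm := ⟨fun _ _ h => ⟨h.1.symm, h.2.imp Adj.symm fun ⟨w, h, h'⟩ => ⟨w, h'.symm, h.symm⟩⟩⟩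
  loopless := ⟨fun _ h => h.1 rfl⟩

/-- A walk never has two consecutive vertices outside a vertex cover, so each outside vertex is
skipped by one edge of the square. The second clause of `key` treats a walk starting outside, with a
cover vertex `x` just before it. -/
lemma squareInduce_preconnected (hG : G.Preconnected) {A : Set V} (hA : G.IsVertexCover A) :
    (G.squareInduce A).Preconnected := by
  have key {u v : V} (p : G.Walk u v) (hv : v ∈ A) :
      (∀ hu : u ∈ A, (G.squareInduce A).Reachable ⟨u, hu⟩ ⟨v, hv⟩) ∧
      (u ∉ A → ∀ (x : V) (hx : x ∈ A), G.Adj x u →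
        (G.squareInduce A).Reachable ⟨x, hx⟩ ⟨v, hv⟩) := by
    induction p with
    | nil => exact ⟨fun _ => .rfl, fun h => absurd hv h⟩
    | @cons u w _ hadj q ih =>
      obtain ⟨ih₁, ih₂⟩ := ih hv
      constructor
      · intro hu
        by_cases hw : w ∈ A
        · refine .trans (Adj.reachable ⟨?_, .inl hadj⟩) (ih₁ hw)
          exact fun h => hadj.ne (congrArg Subtype.val h)
        · exact ih₂ hw u hu hadj
      · intro hu x hx hxu
        have hw : w ∈ A := (hA hadj).resolve_left hu
        by_cases hxw : x = w
        · subst hxw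
          exact ih₁ hx
        · refine .trans (Adj.reachable ⟨?_, .inr ⟨u, hxu, hadj⟩⟩) (ih₁ hw)
          exact fun h => hxw (congrArg Subtype.val h)
  intro u v
  obtain ⟨p⟩ := hG u v
  exact (key p v.2).1 u.2

end SimpleGraph

/-! ### Core graph, cover graph and the local output -/

namespace LabeledGraph

open SimpleGraph

variable {N : ℕ}

/-- The vertex is in exactly one of the two covers. -/
def IsCore (I : LabeledGraph N (Bool × Bool)) (v : Fin N) : Prop := (I.label v).1 ≠ (I.label v).2

/-- The vertex is in at least one of the two covers. -/
def IsCover (I : LabeledGraph N (Bool × Bool)) (v : Fin N) : Prop :=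
  (I.label v).1 = true ∨ (I.label v).2 = true

/-- The edges between vertices that are in exactly one of the two covers. -/
def coreGraph (I : LabeledGraph N (Bool × Bool)) : SimpleGraph (Fin N) where
  Adj u v := I.graph.Adj u v ∧ I.IsCore u ∧ I.IsCore v
  symm := ⟨fun _ _ h => ⟨h.1.symm, h.2.2, h.2.1⟩⟩
  loopless := ⟨fun _ h => h.1.ne rfl⟩

/-- The graph that connects vertices of the covers at distance at most `2`. -/
def coverGraph (I : LabeledGraph N (Bool × Bool)) : SimpleGraph (Fin N) where
  Adj u v := u ≠ v ∧ (I.graph.Adj u v ∨ ∃ w, I.graph.Adj u w ∧ I.graph.Adj w v) ∧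
    I.IsCover u ∧ I.IsCover v
  symm := ⟨fun _ _ h => ⟨h.1.symm,
    h.2.1.imp Adj.symm fun ⟨w, h, h'⟩ => ⟨w, h'.symm, h.symm⟩, h.2.2.2, h.2.2.1⟩⟩
  loopless := ⟨fun _ h => h.1 rfl⟩

lemma IsCore.isCover {I : LabeledGraph N (Bool × Bool)} {v : Fin N} (h : I.IsCore v) :
    I.IsCover v := by
  unfold IsCore at h
  unfold IsCover
  cases h1 : (I.label v).1 <;> simp_all

lemma coreGraph_le_coverGraph (I : LabeledGraph N (Bool × Bool)) : I.coreGraph ≤ I.coverGraph :=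
  fun _ _ h => ⟨h.1.ne, .inl h.1, h.2.1.isCover, h.2.2.isCover⟩

lemma isLocal_isCore : IsLocal (N := N) IsCore 0 :=
  isLocal_label.map fun x : Bool × Bool => x.1 ≠ x.2

lemma isLocal_isCover : IsLocal (N := N) IsCover 0 :=
  isLocal_label.map fun x : Bool × Bool => x.1 = true ∨ x.2 = true

lemma isLocal_of_imp {B : Type*} {F : LabeledGraph N (Bool × Bool) → Fin N → Set B} {T : ℕ}
    (h : ∀ I J v b, Agree I J T v → b ∈ F I v → b ∈ F J v) : IsLocal F T :=
  fun I J v hv => Set.Subset.antisymm (fun b => h I J v b hv) fun b => h J I v b hv.symm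

lemma isLocal_coreGraph : IsLocal (N := N) (fun I => I.coreGraph.neighborSet) 1 := by
  refine isLocal_of_imp fun I J v b h hb => ?_
  obtain ⟨hadj, hv, hb⟩ := hb
  refine ⟨(h.mono zero_le_one).adj_iff.1 hadj, ?_, ?_⟩
  · rwa [← isLocal_isCore I J v (h.mono zero_le_one)]
  · rwa [← isLocal_isCore I J b (h.of_within (.of_adj hadj) le_rfl)]

lemma locallyDefined_coreGraph : LocallyDefined (N := N) coreGraph where
  within _ _ _ h := (Within.of_adj h.1).mono one_le_two
  isLocal := isLocal_coreGraph.mono one_le_two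

lemma within_two_of_adj_coverGraph {I : LabeledGraph N (Bool × Bool)} {u v : Fin N}
    (h : I.coverGraph.Adj u v) : I.graph.Within 2 u v := by
  obtain ⟨-, hadj | ⟨w, h, h'⟩, -⟩ := h
  · exact (Within.of_adj hadj).mono one_le_two
  · exact (Within.of_adj h).trans (.of_adj h')

lemma locallyDefined_coverGraph : LocallyDefined (N := N) coverGraph where
  within _ _ _ h := within_two_of_adj_coverGraph h
  isLocal := by
    refine isLocal_of_imp fun I J v b h hb => ?_
    have hw := within_two_of_adj_coverGraph hb
    obtain ⟨hne, hadj, hv, hb⟩ := hb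
    refine ⟨hne, hadj.imp (fun hadj => (h.mono zero_le_two).adj_iff.1 hadj) ?_, ?_, ?_⟩
    · rintro ⟨w, h1, h2⟩
      exact ⟨w, (h.mono zero_le_two).adj_iff.1 h1,
        (h.of_within (t := 0) (.of_adj h1) one_le_two).adj_iff.1 h2⟩
    · rwa [← isLocal_isCover I J v (h.mono zero_le_two)]
    · rwa [← isLocal_isCover I J b (h.of_within hw le_rfl)]

variable (f₁ f₂ : LabeledGraph N (Bool × Bool) → Fin N → Fin N)

/-- The vertex is the smaller endpoint of an edge between different fragments of the core. -/
def IsSeparator (I : LabeledGraph N (Bool × Bool)) (v : Fin N) : Prop :=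
  ∃ u, I.coreGraph.Adj v u ∧ f₁ I v ≠ f₁ I u ∧ v < u

open Classical in
/-- The vertex itself, or a neighbor for vertices outside the covers. -/
noncomputable def anchor (I : LabeledGraph N (Bool × Bool)) (v : Fin N) : Fin N :=
  if I.IsCover v then v else pick (I.graph.neighborSet v) v

/-- The label of the cluster of a vertex. -/
noncomputable def clusterLabel (I : LabeledGraph N (Bool × Bool)) (v : Fin N) : Fin N :=
  f₂ I (I.anchor v)

/-- The vertex lists of short paths. -/
def pathLists (I : LabeledGraph N (Bool × Bool)) (D : ℕ) (v w : Fin N) : Set (List ℕ) :=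
  {l | ∃ p : I.graph.Walk v w, p.IsPath ∧ p.length ≤ D ∧ l = p.support.map Fin.val}

open Classical in
/-- The output of a vertex. -/
noncomputable def decompOutput (D : ℕ) (I : LabeledGraph N (Bool × Bool)) (v : Fin N) :
    DecompOutput :=
  if IsSeparator f₁ I v then .separator
  else .clustered (clusterLabel f₂ I v) (pick (I.pathLists D v (clusterLabel f₂ I v)) [])

variable {f₁ f₂} {T D : ℕ}

lemma isLocal_isSeparator (h₁ : IsLocal f₁ T) : IsLocal (IsSeparator f₁) (T + 1) := by
  have key (I J : LabeledGraph N (Bool × Bool)) (v) (h : Agree I J (T + 1) v)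
      (hI : IsSeparator f₁ I v) : IsSeparator f₁ J v := by
    obtain ⟨u, hadj, hne, hlt⟩ := hI
    refine ⟨u, ?_, ?_, hlt⟩
    · have h' : I.coreGraph.neighborSet v = J.coreGraph.neighborSet v :=
        isLocal_coreGraph I J v (h.mono (by omega))
      rw [← mem_neighborSet, ← h']
      exact hadj
    · rwa [← h₁ I J v (h.mono (by omega)),
        ← h₁ I J u (h.of_within (.of_adj hadj.1) (by omega))]
  exact fun I J v h => propext ⟨key I J v h, key J I v h.symm⟩

lemma isLocal_anchor : IsLocal (N := N) anchor 0 := by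
  intro I J v h
  unfold anchor
  rw [isLocal_isCover I J v h, show I.graph.neighborSet v = _ from isLocal_neighborSet I J v h]

lemma within_anchor (I : LabeledGraph N (Bool × Bool)) (v : Fin N) :
    I.graph.Within 1 v (I.anchor v) := by
  unfold anchor
  split_ifs with h
  · exact .refl _ _
  · by_cases hn : (I.graph.neighborSet v).Nonempty
    · exact .of_adj (pick_mem hn v)
    · rw [pick_of_not_nonempty hn]
      exact .refl _ _

lemma isLocal_clusterLabel (h₂ : IsLocal f₂ T) : IsLocal (clusterLabel f₂) (T + 1) :=
  h₂.comp isLocal_anchor within_anchor (Nat.zero_le _)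

/-- All edges of a path of length at most `D` start in the ball of radius `D`, where the graphs have
the same edges. -/
lemma pathLists_subset {I J : LabeledGraph N (Bool × Bool)} {v : Fin N} (h : Agree I J D v)
    (w : Fin N) : I.pathLists D v w ⊆ J.pathLists D v w := by
  rintro _ ⟨p, hp, hD, rfl⟩
  have hedge (x) (hx : x ∈ p.edges) : x ∈ J.graph.edgeSet := by
    have hxI := p.edges_subset_edgeSet hx
    induction x with
    | _ a b =>
      have ha : I.graph.Within D v a := .of_mem_support hD (p.fst_mem_support_of_mem_edges hx)
      exact (h.of_within (t := 0) ha (by omega)).adj_iff.1 hxI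
  exact ⟨p.transfer _ hedge, hp.transfer hedge, by simpa using hD, by simp⟩

lemma isLocal_decompOutput (h₁ : IsLocal f₁ T) (h₂ : IsLocal f₂ T) (hD : D ≤ T + 1) :
    IsLocal (decompOutput f₁ f₂ D) (T + 1) := by
  intro I J v h
  unfold decompOutput
  rw [isLocal_isSeparator h₁ I J v h, isLocal_clusterLabel h₂ I J v h,
    (pathLists_subset (h.mono hD) _).antisymm (pathLists_subset (h.mono hD).symm _)]

/-- The two partitions into fragments that underlie the decomposition. -/
lemma exists_fragmentations (N k : ℕ) :
    ∃ f₁ f₂ : LabeledGraph N (Bool × Bool) → Fin N → Fin N,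
      Fragmentation coreGraph f₁ (2 ^ k) (96 * 2 ^ k) (420 * (logStar N + 1) * 2 ^ k) ∧
      Fragmentation coverGraph f₂ (2 ^ k) (192 * 2 ^ k) (420 * (logStar N + 1) * 2 ^ k) ∧
      ∀ I u v, f₁ I u = f₁ I v → f₂ I u = f₂ I v := by
  obtain ⟨f₁, hf₁, -⟩ := (fragmentation_id (N := N) (In := Bool × Bool) coreGraph).exists_pow
    locallyDefined_coreGraph k
  -- The second run starts from the fragments of the first, with the size bound reset to 1, so it
  -- coarsens them. The costs add up: 192 = 96 + 96 and 420 = 210 + 210.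
  obtain ⟨f₂, hf₂, h⟩ := (hf₁.change coreGraph_le_coverGraph).exists_pow
    locallyDefined_coverGraph k
  refine ⟨f₁, f₂, ⟨hf₁.isLocal.mono (by rw [zero_add]; gcongr; norm_num), hf₁.reachable,
    fun I v => (hf₁.within I v).mono (by omega), hf₁.card⟩, ?_, h⟩
  convert hf₂ using 1 <;> ring

end LabeledGraph

/-! ### Correctness of the outputs on a network -/

open LabeledGraph SimpleGraph

section Decomposition

variable {V : Type*} [DecidableEq V] {G : SimpleGraph V} {α β : Finset V}
  (W : LocalNetwork G) {N : ℕ} (hN : ∀ v, W.id v < N)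

/-- The labeled graph of a network in which the nodes know whether they are in `α` and `β`. -/
noncomputable def coverInstance (α β : Finset V) : LabeledGraph N (Bool × Bool) :=
  W.toLabeled hN (fun v => (decide (v ∈ α), decide (v ∈ β))) (false, false)

variable {W hN}

lemma isCore_coverInstance {v : V} :
    (coverInstance W hN α β).IsCore (W.emb hN v) ↔ v ∈ symmDiff α β := by
  rw [IsCore, coverInstance, W.toLabeled_label, Finset.mem_symmDiff]
  by_cases h : v ∈ α <;> by_cases h' : v ∈ β <;> simp [h, h']

lemma isCover_coverInstance {v : V} :
    (coverInstance W hN α β).IsCover (W.emb hN v) ↔ v ∈ α ∪ β := by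
  rw [IsCover, coverInstance, W.toLabeled_label, Finset.mem_union]
  simp

/-- Unused identifiers carry the label `(false, false)` and thus are neither core nor cover
vertices. -/
lemma exists_of_isCore {j : Fin N} (h : (coverInstance W hN α β).IsCore j) :
    ∃ v, W.emb hN v = j := by
  by_contra hj
  exact h (by rw [coverInstance, W.toLabeled_label_of_notMem hN _ _ hj])

lemma exists_of_isCover {j : Fin N} (h : (coverInstance W hN α β).IsCover j) :
    ∃ v, W.emb hN v = j := by
  by_contra hj
  rw [IsCover, coverInstance, W.toLabeled_label_of_notMem hN _ _ hj] at h
  simp at h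

lemma coverInstance_adj {u v : V} :
    (coverInstance W hN α β).graph.Adj (W.emb hN u) (W.emb hN v) ↔ G.Adj u v :=
  map_adj_apply

lemma coreGraph_coverInstance : (coverInstance W hN α β).coreGraph =
    (G.induce ((symmDiff α β : Finset V) : Set V)).map
      ((Function.Embedding.subtype _).trans (W.emb hN)) := by
  ext j k
  rw [map_adj]
  constructor
  · rintro ⟨h, hj, hk⟩
    obtain ⟨u, rfl⟩ := exists_of_isCore hj
    obtain ⟨v, rfl⟩ := exists_of_isCore hk
    have h' : G.Adj u v := coverInstance_adj.1 h
    exact ⟨⟨u, isCore_coverInstance.1 hj⟩, ⟨v, isCore_coverInstance.1 hk⟩, h', rfl, rfl⟩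
  · rintro ⟨u, v, h, rfl, rfl⟩
    exact ⟨coverInstance_adj.2 h, isCore_coverInstance.2 u.2, isCore_coverInstance.2 v.2⟩

lemma coverGraph_coverInstance : (coverInstance W hN α β).coverGraph =
    (G.squareInduce ((α ∪ β : Finset V) : Set V)).map
      ((Function.Embedding.subtype _).trans (W.emb hN)) := by
  ext j k
  rw [map_adj]
  constructor
  · rintro ⟨hne, h, hj, hk⟩
    obtain ⟨u, rfl⟩ := exists_of_isCover hj
    obtain ⟨v, rfl⟩ := exists_of_isCover hk
    refine ⟨⟨u, isCover_coverInstance.1 hj⟩, ⟨v, isCover_coverInstance.1 hk⟩,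
      ⟨fun h => hne (congrArg (fun x => W.emb hN x.1) h), h.imp coverInstance_adj.1 ?_⟩, rfl, rfl⟩
    rintro ⟨l, h1, h2⟩
    obtain ⟨w, rfl, -⟩ := W.exists_of_within hN (.of_adj h1)
    exact ⟨w, coverInstance_adj.1 h1, coverInstance_adj.1 h2⟩
  · rintro ⟨u, v, ⟨hne, h⟩, rfl, rfl⟩
    refine ⟨fun h => hne (((Function.Embedding.subtype _).trans (W.emb hN)).injective h),
      h.imp coverInstance_adj.2 ?_, isCover_coverInstance.2 u.2, isCover_coverInstance.2 v.2⟩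
    rintro ⟨w, h1, h2⟩
    exact ⟨_, coverInstance_adj.2 h1, coverInstance_adj.2 h2⟩

variable {f₁ f₂ : LabeledGraph N (Bool × Bool) → Fin N → Fin N} {t R T : ℕ}

lemma mul_card_separator_le (h₁ : Fragmentation coreGraph f₁ t R T)
    (hcactus : (G.induce ((symmDiff α β : Finset V) : Set V)).IsCactus) (S : Finset V)
    (hS : ∀ v ∈ S, IsSeparator f₁ (coverInstance W hN α β) (W.emb hN v)) :
    t * S.card ≤ 2 * (symmDiff α β).card := by
  have hconn := h₁.reachable (coverInstance W hN α β)
  have hcard := h₁.card (coverInstance W hN α β)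
  rw [coreGraph_coverInstance] at hconn hcard
  have hsub (v) (hv : v ∈ S) : v ∈ symmDiff α β := by
    obtain ⟨u, h, -⟩ := hS v hv
    exact isCore_coverInstance.1 h.2.1
  have := card_lower_endpoints_le hcactus (reachable_intra_comp hconn)
    (le_card_fiber_comp hconn hcard) ((Function.Embedding.subtype _).trans (W.emb hN))
    (S.subtype (· ∈ ((symmDiff α β : Finset V) : Set V))) ?_
  · rw [Finset.card_subtype, Finset.filter_true_of_mem (p := (· ∈ ((symmDiff α β : Finset V) : Set V))) hsub] at this
    simpa using this
  · intro v hv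
    obtain ⟨k, h, hne, hlt⟩ := hS v (Finset.mem_subtype.1 hv)
    obtain ⟨u, rfl⟩ := exists_of_isCore h.2.2
    have h' : G.Adj v u := coverInstance_adj.1 h.1
    exact ⟨⟨u, isCore_coverInstance.1 h.2.2⟩, h', hne, hlt⟩

/-- Every vertex is represented by a vertex of the cover, unless there is only one vertex. -/
lemma exists_clusterLabel_eq (hG : G.Connected) (hα : G.IsVertexCover (α : Set V))
    (hV : Nontrivial V) (v : V) :
    ∃ w ∈ α ∪ β, clusterLabel f₂ (coverInstance W hN α β) (W.emb hN v) =
      f₂ (coverInstance W hN α β) (W.emb hN w) := by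
  by_cases hv : v ∈ α ∪ β
  · refine ⟨v, hv, ?_⟩
    rw [clusterLabel, anchor, if_pos (isCover_coverInstance.2 hv)]
  · obtain ⟨u, hu⟩ := hG.preconnected.exists_adj_of_nontrivial v
    have hne : ((coverInstance W hN α β).graph.neighborSet (W.emb hN v)).Nonempty :=
      ⟨W.emb hN u, (coverInstance_adj (α := α) (β := β)).2 hu⟩
    have hmem : (coverInstance W hN α β).graph.Adj (W.emb hN v) _ := pick_mem hne (W.emb hN v)
    obtain ⟨w, hw, -⟩ := W.exists_of_within hN (.of_adj hmem)
    rw [← hw, coverInstance_adj] at hmem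
    refine ⟨w, ?_, ?_⟩
    · rw [Finset.mem_union, not_or] at hv
      exact Finset.mem_union_left _ (Finset.mem_coe.1 ((hα hmem).resolve_left hv.1))
    · rw [clusterLabel, anchor, if_neg (mt isCover_coverInstance.1 hv), hw]

/-- The path that a vertex outputs leads to the leader of its cluster. -/
lemma exists_path_clusterLabel {D : ℕ} (h₂ : Fragmentation coverGraph f₂ t R T) (hD : R + 1 ≤ D)
    (v : V) : ∃ u, W.emb hN u = clusterLabel f₂ (coverInstance W hN α β) (W.emb hN v) ∧
      ∃ p : G.Walk v u, p.IsPath ∧ p.length ≤ D ∧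
        pick ((coverInstance W hN α β).pathLists D (W.emb hN v)
          (clusterLabel f₂ (coverInstance W hN α β) (W.emb hN v))) [] = p.support.map W.id := by
  classical
  have hw : (coverInstance W hN α β).graph.Within D (W.emb hN v)
      (clusterLabel f₂ (coverInstance W hN α β) (W.emb hN v)) :=
    ((within_anchor _ _).trans (h₂.within _ _)).mono (by omega)
  obtain ⟨q, hq⟩ := hw
  obtain ⟨p, hp, hpD, hl⟩ := pick_mem (S := (coverInstance W hN α β).pathLists D (W.emb hN v)
    (clusterLabel f₂ (coverInstance W hN α β) (W.emb hN v)))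
    ⟨_, q.bypass, q.bypass_isPath, q.length_bypass_le_length.trans hq, rfl⟩ []
  obtain ⟨u, hu, r, hr⟩ : ∃ u, clusterLabel f₂ (coverInstance W hN α β) (W.emb hN v) = W.emb hN u ∧
      ∃ r : G.Walk v u, p.support = r.support.map (W.emb hN) := exists_lift_walk (G := G) p rfl
  refine ⟨u, hu.symm, r, ?_, ?_, ?_⟩
  · have := hp.support_nodup
    rw [hr] at this
    exact r.isPath_def.2 this.of_map
  · have := congrArg List.length hr
    rw [List.length_map, Walk.length_support, Walk.length_support] at this
    omega
  · rw [hl, hr, List.map_map]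
    rfl

variable [Fintype V]

/-- Through anchors, every cluster label already occurs on `α ∪ β`. If there are two labels,
connectedness of the square graph gives every fragment there at least `t` vertices. -/
lemma card_clusterLabels_le (hG : G.Connected) (hα : G.IsVertexCover (α : Set V))
    (h₂ : Fragmentation coverGraph f₂ t R T) :
    (Finset.univ.image fun v => clusterLabel f₂ (coverInstance W hN α β) (W.emb hN v)).card ≤ 1 ∨
    t * (Finset.univ.image fun v => clusterLabel f₂ (coverInstance W hN α β) (W.emb hN v)).card ≤
      (α ∪ β).card := by
  refine or_iff_not_imp_left.2 fun hlt => ?_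
  push Not at hlt
  obtain ⟨a, ha, b, hb, hab⟩ := Finset.one_lt_card.1 hlt
  obtain ⟨u, -, rfl⟩ := Finset.mem_image.1 ha
  obtain ⟨v, -, rfl⟩ := Finset.mem_image.1 hb
  have hV : Nontrivial V := ⟨u, v, fun h => hab (by rw [h])⟩
  obtain ⟨u', hu, hu'⟩ := exists_clusterLabel_eq (f₂ := f₂) (hN := hN) (β := β) hG hα hV u
  obtain ⟨v', hv, hv'⟩ := exists_clusterLabel_eq (f₂ := f₂) (hN := hN) (β := β) hG hα hV v
  have hconn := h₂.reachable (coverInstance W hN α β)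
  have hcard := h₂.card (coverInstance W hN α β)
  rw [coverGraph_coverInstance] at hconn hcard
  have hcov : G.IsVertexCover ((α ∪ β : Finset V) : Set V) := fun a b h =>
    (hα h).imp (fun h => Finset.mem_coe.2 (Finset.mem_union_left _ h))
      fun h => Finset.mem_coe.2 (Finset.mem_union_left _ h)
  have := mul_card_labels_le (squareInduce_preconnected hG.preconnected hcov)
    (le_card_fiber_comp hconn hcard) ⟨⟨u', hu⟩, ⟨v', hv⟩, fun h => hab (hu'.trans (h.trans hv'.symm))⟩
  refine le_trans (Nat.mul_le_mul_left _ (Finset.card_le_card fun l hl => ?_))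
    (this.trans_eq (by simp))
  obtain ⟨x, -, rfl⟩ := Finset.mem_image.1 hl
  obtain ⟨w, hw, h⟩ := exists_clusterLabel_eq (f₂ := f₂) (hN := hN) (β := β) hG hα hV x
  exact Finset.mem_image.2 ⟨⟨w, hw⟩, Finset.mem_univ _, h.symm⟩

/-- The outputs describe a separator decomposition. -/
theorem exists_decomposition (hG : G.Connected) (hα : G.IsVertexCover (α : Set V))
    (hcactus : (G.induce ((symmDiff α β : Finset V) : Set V)).IsCactus)
    (h₁ : Fragmentation coreGraph f₁ t R T) (h₂ : Fragmentation coverGraph f₂ t R T)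
    (h₁₂ : ∀ I u v, f₁ I u = f₁ I v → f₂ I u = f₂ I v) {D : ℕ} (hD : R + 1 ≤ D)
    {ε d : ℝ} (hε : 2 ≤ ε * t) (hd : (2 * D : ℕ) ≤ d) {out : V → DecompOutput}
    (hout : ∀ v, out v = decompOutput f₁ f₂ D (coverInstance W hN α β) (W.emb hN v)) :
    ∃ (k : ℕ) (C : Fin k → Finset V) (S : Finset V),
      IsSeparatorDecomposition G (symmDiff α β)ᶜ d (ε * ((symmDiff α β).card : ℝ)) C S ∧
      (k : ℝ) ≤ max 1 (2 * ε * max (α.card : ℝ) (β.card : ℝ)) ∧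
      OutputsDecomposition W d C S out := by
  classical
  set I := coverInstance W hN α β with hI
  let φ (v : V) : Fin N := clusterLabel f₂ I (W.emb hN v)
  let S : Finset V := Finset.univ.filter fun v => IsSeparator f₁ I (W.emb hN v)
  have hS {v : V} : v ∈ S ↔ IsSeparator f₁ I (W.emb hN v) := by simp [S]
  let Λ : Finset (Fin N) := Sᶜ.image φ
  let C (i : Fin Λ.card) : Finset V := Sᶜ.filter fun v => φ v = (Λ.equivFin.symm i : Fin N)
  have hC {i : Fin Λ.card} {v : V} : v ∈ C i ↔ v ∉ S ∧ φ v = (Λ.equivFin.symm i : Fin N) := by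
    simp [C]
  have hlabel {i j : Fin Λ.card} (h : (Λ.equivFin.symm i : Fin N) = Λ.equivFin.symm j) : i = j :=
    Λ.equivFin.symm.injective (Subtype.ext h)
  have hCne (i : Fin Λ.card) : (C i).Nonempty := by
    obtain ⟨v, hv, h⟩ := Finset.mem_image.1 (Λ.equivFin.symm i).2
    exact ⟨v, hC.2 ⟨Finset.mem_compl.1 hv, h⟩⟩
  have hpath := exists_path_clusterLabel (α := α) (β := β) (hN := hN) h₂ hD
  have hd0 : (D : ℝ) ≤ d := le_trans (by push_cast; linarith [Nat.cast_nonneg (α := ℝ) D]) hd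
  have ht : (0 : ℝ) < t := by
    rcases Nat.eq_zero_or_pos t with h | h
    · norm_num [h] at hε
    · exact_mod_cast h
  refine ⟨Λ.card, C, S, ⟨hCne, ?_, ?_, ?_, ?_, ?_, ?_⟩, ?_, ?_, ?_⟩
  · intro i j hij
    rw [Finset.disjoint_left]
    exact fun v hi hj => hij (hlabel ((hC.1 hi).2.symm.trans (hC.1 hj).2))
  · intro i
    rw [Finset.disjoint_left]
    exact fun v hi => (hC.1 hi).1
  · intro v
    refine or_iff_not_imp_left.2 fun hv => ?_
    have hm : φ v ∈ Λ := Finset.mem_image_of_mem _ (Finset.mem_compl.2 hv)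
    exact ⟨Λ.equivFin ⟨φ v, hm⟩, hC.2 ⟨hv, by simp⟩⟩
  -- Both vertices have paths of length at most `D` to the common leader, whence the factor 2 in the
  -- bound on `d`.
  · intro i u hu v hv
    obtain ⟨a, ha, p, -, hp, -⟩ := hpath u
    obtain ⟨b, hb, q, -, hq, -⟩ := hpath v
    obtain rfl : a = b := (W.emb hN).injective <| by
      rw [ha, hb]
      exact (hC.1 hu).2.trans (hC.1 hv).2.symm
    refine ⟨(p.append q.reverse).reachable, le_trans ?_ hd⟩
    have := dist_le (p.append q.reverse)
    rw [Walk.length_append, Walk.length_reverse] at this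
    exact_mod_cast this.trans (by omega)
  · have hle := mul_card_separator_le h₁ hcactus S fun v hv => hS.1 hv
    have hle' : (t : ℝ) * S.card ≤ 2 * (symmDiff α β).card := by exact_mod_cast hle
    refine le_of_mul_le_mul_left (hle'.trans ?_) ht
    have := mul_le_mul_of_nonneg_right hε (Nat.cast_nonneg (α := ℝ) (symmDiff α β).card)
    linarith
  · intro i j hij u hu v hv hadj
    rw [Finset.mem_sdiff, Finset.mem_compl, not_not, hC] at hu hv
    have hu' := isCore_coverInstance (W := W) (hN := hN).2 hu.2
    have hv' := isCore_coverInstance (W := W) (hN := hN).2 hv.2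
    have hadj' : I.coreGraph.Adj (W.emb hN u) (W.emb hN v) :=
      ⟨coverInstance_adj.2 hadj, hu', hv'⟩
    -- Core vertices are their own anchors and `f₂` coarsens `f₁`, so different clusters mean
    -- different core fragments. The endpoint with the smaller identifier would then be in `S`.
    have hne : f₁ I (W.emb hN u) ≠ f₁ I (W.emb hN v) := by
      intro h
      refine hij (hlabel ?_)
      rw [← hu.1.2, ← hv.1.2]
      simp only [φ, clusterLabel, anchor, hI, if_pos hu'.isCover, if_pos hv'.isCover]
      exact h₁₂ I _ _ h
    obtain h | h := lt_or_gt_of_ne fun h => hadj.ne ((W.emb hN).injective h)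
    · exact hu.1.1 (hS.2 ⟨_, hadj', hne, h⟩)
    · exact hv.1.1 (hS.2 ⟨_, hadj'.symm, hne.symm, h⟩)
  · have hΛ : Λ.card ≤ (Finset.univ.image φ).card :=
      Finset.card_le_card (Finset.image_subset_image (Finset.subset_univ _))
    obtain h | h := card_clusterLabels_le (hN := hN) (β := β) hG hα h₂
    · exact le_max_of_le_left (by exact_mod_cast hΛ.trans h)
    · refine le_max_of_le_right ?_
      have h1 : (t : ℝ) * Λ.card ≤ α.card + β.card := by
        exact_mod_cast (Nat.mul_le_mul_left t hΛ).trans (h.trans (Finset.card_union_le α β))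
      have h2 := le_max_left (α.card : ℝ) β.card
      have h3 := le_max_right (α.card : ℝ) β.card
      -- From `|α| + |β| ≤ 2M` and `2 ≤ ε * t`, even `εM` would suffice.
      refine le_of_mul_le_mul_left (h1.trans ?_) ht
      have := mul_le_mul_of_nonneg_right hε
        ((Nat.cast_nonneg (α := ℝ) α.card).trans h2)
      have h4 : (0 : ℝ) ≤ max (α.card : ℝ) β.card := (Nat.cast_nonneg _).trans h2
      linarith
  · intro v hv
    rw [hout, decompOutput, if_pos (hS.1 hv)]
  · choose x hx using hCne
    choose l hl p hp hpD hpick using hpath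
    refine ⟨fun i => (Λ.equivFin.symm i : Fin N), fun i => l (x i),
      fun i j h => hlabel (Fin.ext h), fun i v hv => ?_⟩
    have hlv : l v = l (x i) := (W.emb hN).injective <| by
      rw [hl, hl]
      exact (hC.1 hv).2.trans (hC.1 (hx i)).2.symm
    beta_reduce
    rw [← hlv]
    refine ⟨p v, hp v, le_trans (by exact_mod_cast hpD v) hd0, ?_⟩
    rw [hout, decompOutput, if_neg (mt hS.2 (hC.1 hv).1), ← hpick, ← (hC.1 hv).2]

end Decomposition

/-! ### Choice of parameters and the theorem -/

/-- A power of two that is about `2 / ε`. -/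
lemma exists_two_pow_near {ε : ℝ} (hε : 0 < ε) :
    ∃ k : ℕ, 2 ≤ ε * (2 ^ k : ℕ) ∧ ((2 ^ k : ℕ) : ℝ) ≤ 6 * max 1 (1 / ε) := by
  set n := ⌈2 / ε⌉₊
  have hn0 : 0 < n := Nat.ceil_pos.2 (by positivity)
  have hn : 2 / ε ≤ n := Nat.le_ceil _
  have hn' : (n : ℝ) < 2 / ε + 1 := Nat.ceil_lt_add_one (by positivity)
  -- Rounding `n` up to a power of two at most doubles it, and `2 * (2 / ε + 1) ≤ 6 * max 1 (1 /
  -- ε)`.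
  refine ⟨Nat.clog 2 n, ?_, ?_⟩
  · have h : (n : ℝ) ≤ (2 ^ Nat.clog 2 n : ℕ) := by
      exact_mod_cast Nat.le_pow_clog one_lt_two n
    rw [div_le_iff₀ hε] at hn
    nlinarith
  · have h : 2 ^ Nat.clog 2 n ≤ 2 * n := by
      obtain h1 | h1 : n = 1 ∨ 1 < n := by omega
      · simp [h1]
      · have := Nat.pow_pred_clog_lt_self one_lt_two h1
        have hc := Nat.clog_pos one_lt_two h1
        rw [← Nat.succ_pred_eq_of_pos hc, pow_succ]
        omega
    have h' : ((2 ^ Nat.clog 2 n : ℕ) : ℝ) ≤ 2 * n := by exact_mod_cast h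
    have h1 := le_max_left (1 : ℝ) (1 / ε)
    have h2 := le_max_right (1 : ℝ) (1 / ε)
    rw [show 2 / ε = 2 * (1 / ε) by ring] at hn'
    linarith

theorem lemma16 :
    ∃ K : ℝ, ∀ c : ℕ, ∃ K' : ℝ, ∀ ε : ℝ, 0 < ε →
      ∃ A : LocalAlgorithm (Bool × Bool) DecompOutput,
        ∀ (V : Type) [Fintype V] [DecidableEq V] (G : SimpleGraph V) (α β : Finset V),
          G.Connected →
          G.IsVertexCover (α : Set V) →
          G.IsVertexCover (β : Set V) →
          (G.induce ((symmDiff α β : Finset V) : Set V)).IsCactus →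
          ∀ (W : LocalNetwork G) (N : ℕ),
            (∀ v, W.id v < N) →
            N ≤ c * Fintype.card V ^ c →
            (A.rounds N : ℝ) ≤
                K' * (max 1 (1 / ε) * max 1 (logStar (Fintype.card V) : ℝ)) ∧
            ∃ (k : ℕ) (C : Fin k → Finset V) (S : Finset V),
              IsSeparatorDecomposition G (symmDiff α β)ᶜ (K * max 1 (1 / ε))
                (ε * ((symmDiff α β).card : ℝ)) C S ∧
              (k : ℝ) ≤ max 1 (2 * ε * max (α.card : ℝ) (β.card : ℝ)) ∧
              OutputsDecomposition W (K * max 1 (1 / ε)) C S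
                (A.result W N fun v => (decide (v ∈ α), decide (v ∈ β))) := by
  -- The factor 6 comes from `exists_two_pow_near`: 2400 = 400 * 6 with `2 * D ≤ 400 * 2 ^ k`, and
  -- 3000 = 500 * 6 from the round count.
  refine ⟨2400, fun c => ⟨3000 * (c + 4), fun ε hε => ?_⟩⟩
  obtain ⟨k, hk, hk'⟩ := exists_two_pow_near hε
  choose f₁ f₂ h₁ h₂ h₁₂ using fun N => exists_fragmentations N k
  -- The label radius of `f₂`, plus one step to the anchor.
  set D := 192 * 2 ^ k + 1 with hD
  have hpos : 1 ≤ 2 ^ k := Nat.one_le_two_pow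
  refine ⟨.ofLocal (fun N => decompOutput (f₁ N) (f₂ N) D) .separator
    fun N => 420 * (logStar N + 1) * 2 ^ k + 1, ?_⟩
  intro V _ _ G α β hG hα _ hcactus W N hN hNc
  constructor
  · change ((420 * (logStar N + 1) * 2 ^ k + 1 + 1 : ℕ) : ℝ) ≤ _
    have hL := logStar_le_of_le_mul_pow hNc
    set n := logStar (Fintype.card V)
    have hround : 420 * (logStar N + 1) * 2 ^ k + 1 + 1 ≤ 500 * (n + c + 3) * 2 ^ k := by
      have : 420 * (logStar N + 1) * 2 ^ k ≤ 420 * (n + c + 3) * 2 ^ k := by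
        have hle : logStar N + 1 ≤ n + c + 3 := by omega
        gcongr
      nlinarith
    have h1 := le_max_left (1 : ℝ) n
    have h2 := le_max_right (1 : ℝ) n
    have hn : ((n + c + 3 : ℕ) : ℝ) ≤ (c + 4) * max 1 (n : ℝ) := by
      push_cast
      nlinarith [Nat.cast_nonneg (α := ℝ) c]
    calc ((420 * (logStar N + 1) * 2 ^ k + 1 + 1 : ℕ) : ℝ)
        ≤ ((500 * (n + c + 3) * 2 ^ k : ℕ) : ℝ) := by exact_mod_cast hround
      _ = 500 * ((n + c + 3 : ℕ) : ℝ) * (2 ^ k : ℕ) := by push_cast; ring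
      _ ≤ 500 * ((c + 4) * max 1 (n : ℝ)) * (6 * max 1 (1 / ε)) := by gcongr
      _ = _ := by ring
  · refine exists_decomposition (hN := hN) hG hα hcactus
      ⟨(h₁ N).isLocal, (h₁ N).reachable, fun I v => ((h₁ N).within I v).mono ?_, (h₁ N).card⟩
      (h₂ N) (h₁₂ N) hD.ge hk ?_ fun v => ?_
    · omega
    · have : ((2 * D : ℕ) : ℝ) ≤ 400 * (2 ^ k : ℕ) := by
        exact_mod_cast (by omega : 2 * D ≤ 400 * 2 ^ k)
      linarith
    · refine LocalAlgorithm.result_ofLocal _ _ _ W ?_ hN _ (false, false) v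
      exact isLocal_decompOutput (h₁ N).isLocal (h₂ N).isLocal (by nlinarith)
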